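/- Let $K$ be a non-archimedean local field with ring of integers $\mathcal O_K$, uniformizer $\pi$ and residue field $k$. An order $\mathfrak H$ in $\mathbb M_2(K)$ (of arbitrary rank) is a unital $\mathcal O_K$-subalgebra of $\mathbb M_2(K)$ that is finitely generated as an $\mathcal O_K$-module; it has maximal rank if its rank over $\mathcal O_K$ is $4$. An Eichler order is an intersection of two (possibly equal) maximal orders. For an order $\mathfrak H$ and an integer $s\ge 0$ put $\mathfrak H^{[s]}=\mathcal O_K+\pi^s\mathfrak H$. Let $\mathfrak T$ be the Bruhat–Tits tree of $PGL_2(K)$: its vertices are the maximal orders in $\mathbb M_2(K)$, and $\mathfrak D_1,\mathfrak D_2$ are joined by an edge if and only if $[\mathfrak D_1:\mathfrak D_1\cap\mathfrak D_2]=|k|$. For $r\ge 0$, the $r$-branch of $\mathfrak H$ is the set of vertices $$S_r(\mathfrak H)=\{\mathfrak D : \mathfrak H\subseteq \mathfrak D^{[r]}\}.$$ A set of vertices of $\mathfrak T$ is called an $r$-thick path if it consists of all vertices at distance at most $r$ from some path without repeated vertices, where the path is non-empty and may be finite (possibly a single vertex), infinite in one direction, or infinite in both directions. Let $\mathfrak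 H$ be an order in $\mathbb M_2(K)$. Then: 1. If $r\ge 0$ is such that $S_r(\mathfrak H)\neq\emptyset$ and $S_{r+1}(\mathfrak H)=\emptyset$, then for every integer $k$ with $0\le k\le r$ the branch $S_k(\mathfrak H)$ is an $(r-k)$-thick path. 2. If $\mathfrak H$ is contained in only finitely many maximal orders, then there exist an Eichler order $\mathfrak D$ and an integer $t\ge 0$ such that $S_r(\mathfrak H)=S_r(\mathfrak D^{[t]})$ for every integer $r\ge 0$. 3. If $\mathfrak H$ has maximal rank, then $\mathfrak H$ is contained in only finitely many maximal orders; in particular the conclusion of 2 holds for $\mathfrak H$. -/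

import Mathlib

open scoped ValuativeRel

namespace BruhatTits

section

variable {K : Type*} [Field K] [ValuativeRel K]

/-- An order of arbitrary rank in `M₂(K)`: a unital `𝒪[K]`-subalgebra that is finitely generated
as an `𝒪[K]`-module. -/
def IsOrder (H : Subalgebra 𝒪[K] (Matrix (Fin 2) (Fin 2) K)) : Prop :=
  (Subalgebra.toSubmodule H).FG

/-- A maximal order of `M₂(K)`: an order that is maximal under inclusion. -/
def IsMaximalOrder (D : Subalgebra 𝒪[K] (Matrix (Fin 2) (Fin 2) K)) : Prop :=
  Maximal IsOrder D

variable (K) in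
/-- The vertices of the Bruhat-Tits tree of `PGL₂(K)`: the maximal orders of `M₂(K)`. -/
def Vertex : Type _ :=
  {D : Subalgebra 𝒪[K] (Matrix (Fin 2) (Fin 2) K) // IsMaximalOrder D}

/-- The index `[D₁ : D₁ ∩ D₂]` of additive groups. -/
noncomputable def orderIndex (D₁ D₂ : Subalgebra 𝒪[K] (Matrix (Fin 2) (Fin 2) K)) : ℕ :=
  (Subalgebra.toSubmodule D₂).toAddSubgroup.relIndex (Subalgebra.toSubmodule D₁).toAddSubgroup

variable (K) in
/-- The Bruhat-Tits tree of `PGL₂(K)`: two maximal orders are joined by an edge when the index of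
their intersection in them is the cardinality of the residue field. (The two indices
`[D₁ : D₁ ∩ D₂]` and `[D₂ : D₁ ∩ D₂]` are always equal; `fromRel` makes the symmetry formal.) -/
noncomputable def tree : SimpleGraph (Vertex K) :=
  SimpleGraph.fromRel fun D₁ D₂ => orderIndex D₁.1 D₂.1 = Nat.card 𝓀[K]

/-- `H^{[s]} = 𝒪[K] + ϖ ^ s H`. -/
def deepening (ϖ : 𝒪[K]) (s : ℕ) (H : Subalgebra 𝒪[K] (Matrix (Fin 2) (Fin 2) K)) :
    Subalgebra 𝒪[K] (Matrix (Fin 2) (Fin 2) K) where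
  carrier := {x | ∃ c : 𝒪[K], ∃ h ∈ H, x = algebraMap 𝒪[K] _ c + ϖ ^ s • h}
  mul_mem' := by
    rintro _ _ ⟨c, h, hh, rfl⟩ ⟨c', h', hh', rfl⟩
    refine ⟨c * c', c • h' + c' • h + ϖ ^ s • (h * h'),
      H.add_mem (H.add_mem (H.smul_mem hh' _) (H.smul_mem hh _))
        (H.smul_mem (H.mul_mem hh hh') _), ?_⟩
    simp only [Algebra.algebraMap_eq_smul_one, add_mul, mul_add, smul_mul_assoc, mul_smul_comm,
      one_mul, mul_one, smul_add, smul_smul]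
    rw [mul_comm (ϖ ^ s) c, mul_comm (ϖ ^ s) c', mul_comm c' c]
    abel
  add_mem' := by
    rintro _ _ ⟨c, h, hh, rfl⟩ ⟨c', h', hh', rfl⟩
    refine ⟨c + c', h + h', H.add_mem hh hh', ?_⟩
    rw [map_add, smul_add]
    abel
  algebraMap_mem' c := ⟨c, 0, H.zero_mem, by simp⟩

/-- The `r`-branch `S_r(H)`: the maximal orders `D` with `H ⊆ D^{[r]}`. -/
def branch (ϖ : 𝒪[K]) (r : ℕ) (H : Subalgebra 𝒪[K] (Matrix (Fin 2) (Fin 2) K)) :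
    Set (Vertex K) :=
  {D | H ≤ deepening ϖ r D.1}

/-- An Eichler order: the intersection of two (possibly equal) maximal orders. -/
def IsEichlerOrder (D : Subalgebra 𝒪[K] (Matrix (Fin 2) (Fin 2) K)) : Prop :=
  ∃ D₁ D₂ : Vertex K, D = D₁.1 ⊓ D₂.1

end

section

variable {V : Type*}

/-- `P` is the vertex set of a nonempty path without repeated vertices in the graph `G`. The path
is indexed by an interval `I` of the integers, so it may be finite (possibly a single vertex),
infinite in one direction, or infinite in both directions. -/
def IsPathSet (G : SimpleGraph V) (P : Set V) : Prop :=
  ∃ (I : Set ℤ) (f : ℤ → V), I.Nonempty ∧ I.OrdConnected ∧ Set.InjOn f I ∧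
    (∀ i ∈ I, i + 1 ∈ I → G.Adj (f i) (f (i + 1))) ∧ P = f '' I

/-- `S` is an `r`-thick path in `G`: it consists of all vertices at distance at most `r` from some
finite or infinite path. -/
def IsThickPath (G : SimpleGraph V) (r : ℕ) (S : Set V) : Prop :=
  ∃ P : Set V, IsPathSet G P ∧ S = {v | ∃ w ∈ P, G.edist v w ≤ r}

end

end BruhatTits

/-! Everything is read off one function on the tree: the depth F(D), the largest integer r with H ⊆
K + ϖ^r D. Negative r and scalars from K are allowed, so F is defined at every vertex as soon as H
contains a non-scalar matrix, and S_r(H) = {F ≥ r} for r ≥ 0 (`mem_branch_iff`). A scalar order lies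
deep in every vertex; it is excluded by S_{r+1}(H) = ∅ in part 1 and by the infinitude of the tree
in part 2.

In a suitable basis, membership in K + ϖ^r M₂(𝒪) concerns three quantities: the two off-diagonal
entries and the difference of the diagonal ones. Moving to a neighbour rescales the off-diagonal
entries by ϖ and ϖ⁻¹. This gives the three local properties of `IsRidge` (`isRidge_depth`): F
changes by at most one along an edge; if it increases towards one neighbour it decreases towards all
others; at most two neighbours have depth at least that of the vertex.

The rest is combinatorics. If a ridge function on a tree has maximum M, then {F = M} is convex and
has no branching, so it is a path (`IsRidge.isPathSet`). Away from that path F descends with slope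
one, so {F ≥ k} is its (M - k)-neighbourhood (`IsRidge.setOf_le_eq`). This is part 1. Acyclicity of
the tree itself comes from ridge functions with a strict peak (`isAcyclic_of_isRidge`).

For part 2, the maximal path is a finite segment. The Eichler order E of its two ends has maximal
depth 0, attained exactly on that segment, so E^{[t]} has the same branches as H, with t the maximal
depth of H. For part 3, trace duality traps every maximal order containing H between ϖ^M M₂(𝒪) and
ϖ^{-M} M₂(𝒪), whose quotient is finite. -/

namespace BruhatTits


/-! ### Fractional ideals of a discrete valuation ring -/

section Arithmetic

variable {K : Type*} [Field K] [ValuativeRel K]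

/-- The fractional ideal `ϖ ^ r 𝒪[K]`. -/
def fracIdeal (ϖ : 𝒪[K]) (r : ℤ) : AddSubgroup K where
  carrier := {x | ∃ y : 𝒪[K], x = (ϖ : K) ^ r * y}
  zero_mem' := ⟨0, by simp⟩
  add_mem' := by
    rintro _ _ ⟨y, rfl⟩ ⟨z, rfl⟩
    exact ⟨y + z, by push_cast; ring⟩
  neg_mem' := by
    rintro _ ⟨y, rfl⟩
    exact ⟨-y, by push_cast; ring⟩

theorem mem_fracIdeal {ϖ : 𝒪[K]} {r : ℤ} {x : K} :
    x ∈ fracIdeal ϖ r ↔ ∃ y : 𝒪[K], x = (ϖ : K) ^ r * y := Iff.rfl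

theorem mem_fracIdeal_zero {ϖ : 𝒪[K]} {x : K} : x ∈ fracIdeal ϖ 0 ↔ x ∈ 𝒪[K] := by
  rw [mem_fracIdeal]
  constructor
  · rintro ⟨y, rfl⟩
    simp
  · intro h
    exact ⟨⟨x, h⟩, by simp⟩

theorem mem_integers_or_inv (x : K) : x ∈ 𝒪[K] ∨ x⁻¹ ∈ 𝒪[K] := by
  simp only [Valuation.mem_integer_iff, map_inv₀]
  rcases le_total (ValuativeRel.valuation K x) 1 with h | h
  · exact Or.inl h
  · exact Or.inr (inv_le_one_of_one_le₀ h)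

instance : IsFractionRing 𝒪[K] K := (Valuation.integer.integers _).isFractionRing

variable {ϖ : 𝒪[K]} (hϖ : Irreducible ϖ)
include hϖ

theorem uniformizer_ne_zero : (ϖ : K) ≠ 0 := by
  simpa using hϖ.ne_zero

theorem zpow_mul_mem_fracIdeal {r s : ℤ} {x : K} :
    (ϖ : K) ^ s * x ∈ fracIdeal ϖ r ↔ x ∈ fracIdeal ϖ (r - s) := by
  have h0 := uniformizer_ne_zero hϖ
  simp only [mem_fracIdeal, zpow_sub₀ h0]
  have := zpow_ne_zero s h0
  refine exists_congr fun y => ?_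
  constructor <;> intro h
  · field_simp
    linear_combination h
  · rw [h]
    field_simp

theorem mul_mem_fracIdeal {r s : ℤ} {x y : K} (hx : x ∈ fracIdeal ϖ r) (hy : y ∈ fracIdeal ϖ s) :
    x * y ∈ fracIdeal ϖ (r + s) := by
  obtain ⟨a, rfl⟩ := hx
  obtain ⟨b, rfl⟩ := hy
  refine ⟨a * b, ?_⟩
  rw [zpow_add₀ (uniformizer_ne_zero hϖ)]
  push_cast
  ring

theorem fracIdeal_anti {r s : ℤ} (h : r ≤ s) : fracIdeal ϖ s ≤ fracIdeal ϖ r := by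
  rintro _ ⟨y, rfl⟩
  refine ⟨ϖ ^ (s - r).toNat * y, ?_⟩
  push_cast
  rw [← zpow_natCast, ← mul_assoc, ← zpow_add₀ (uniformizer_ne_zero hϖ)]
  congr 2
  omega

theorem integer_mul_mem_fracIdeal {r : ℤ} {x y : K} (hx : x ∈ 𝒪[K]) (hy : y ∈ fracIdeal ϖ r) :
    x * y ∈ fracIdeal ϖ r := by
  have := mul_mem_fracIdeal hϖ (mem_fracIdeal_zero.2 hx) hy
  rwa [zero_add] at this

theorem one_notMem_fracIdeal {r : ℤ} (hr : 0 < r) : (1 : K) ∉ fracIdeal ϖ r := by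
  intro h
  obtain ⟨y, hy⟩ := fracIdeal_anti hϖ (show (1 : ℤ) ≤ r by omega) h
  apply hϖ.not_isUnit
  refine IsUnit.of_mul_eq_one y ?_
  ext
  simpa using hy.symm

theorem zpow_mem_fracIdeal {r s : ℤ} : (ϖ : K) ^ s ∈ fracIdeal ϖ r ↔ r ≤ s := by
  rw [← mul_one ((ϖ : K) ^ s), zpow_mul_mem_fracIdeal hϖ]
  constructor
  · intro h
    by_contra hlt
    exact one_notMem_fracIdeal hϖ (show 0 < r - s by omega) h
  · intro h
    exact fracIdeal_anti hϖ (show r - s ≤ 0 by omega) (mem_fracIdeal_zero.2 (one_mem _))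

theorem zpow_mul_unit_mem_fracIdeal {n r : ℤ} (u : 𝒪[K]ˣ) :
    (ϖ : K) ^ n * (u : 𝒪[K]) ∈ fracIdeal ϖ r ↔ r ≤ n := by
  rw [← zpow_mem_fracIdeal hϖ]
  constructor
  · intro h
    have := integer_mul_mem_fracIdeal hϖ ((u⁻¹ : 𝒪[K]ˣ) : 𝒪[K]).2 h
    have e : (((u⁻¹ : 𝒪[K]ˣ) : 𝒪[K]) : K) * ((u : 𝒪[K]) : K) = 1 := by
      exact_mod_cast u.inv_mul
    rwa [mul_left_comm, e, mul_one] at this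
  · intro h
    rw [mul_comm]
    exact integer_mul_mem_fracIdeal hϖ (u : 𝒪[K]).2 h

variable [TopologicalSpace K] [IsNonarchimedeanLocalField K]

theorem exists_eq_zpow_mul_unit {x : K} (hx : x ≠ 0) :
    ∃ (n : ℤ) (u : 𝒪[K]ˣ), x = (ϖ : K) ^ n * (u : 𝒪[K]) := by
  have key : ∀ y : K, y ≠ 0 → y ∈ 𝒪[K] → ∃ (n : ℤ) (u : 𝒪[K]ˣ), y = (ϖ : K) ^ n * (u : 𝒪[K]) := by
    intro y hy hyO
    obtain ⟨n, u, hu⟩ := IsDiscreteValuationRing.eq_unit_mul_pow_irreducible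
      (x := (⟨y, hyO⟩ : 𝒪[K])) (by simpa [Subtype.ext_iff] using hy) hϖ
    refine ⟨n, u, ?_⟩
    have := congrArg (Subtype.val) hu
    simpa [mul_comm] using this
  rcases mem_integers_or_inv x with h | h
  · exact key x hx h
  · obtain ⟨n, u, hu⟩ := key _ (inv_ne_zero hx) h
    refine ⟨-n, u⁻¹, ?_⟩
    rw [← inv_inj, hu, mul_inv, zpow_neg, inv_inv]
    congr 1
    apply eq_inv_of_mul_eq_one_left
    exact_mod_cast u.mul_inv

theorem inv_mem_integers_of_notMem_fracIdeal {x : K} (hx : x ∈ 𝒪[K]) (hx1 : x ∉ fracIdeal ϖ 1) :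
    x⁻¹ ∈ 𝒪[K] := by
  have hx0 : x ≠ 0 := by
    rintro rfl
    exact hx1 (zero_mem _)
  obtain ⟨n, u, hu⟩ := exists_eq_zpow_mul_unit hϖ hx0
  have hn : n = 0 := by
    rw [← mem_fracIdeal_zero (ϖ := ϖ)] at hx
    rw [hu, zpow_mul_unit_mem_fracIdeal hϖ] at hx hx1
    omega
  have : x⁻¹ = ((u⁻¹ : 𝒪[K]ˣ) : 𝒪[K]) := by
    rw [hu, hn, zpow_zero, one_mul]
    apply inv_eq_of_mul_eq_one_right
    exact_mod_cast u.mul_inv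
  rw [this]
  exact SetLike.coe_mem _

theorem exists_notMem_fracIdeal {x : K} (hx : x ≠ 0) : ∃ r : ℤ, x ∉ fracIdeal ϖ r := by
  obtain ⟨n, u, rfl⟩ := exists_eq_zpow_mul_unit hϖ hx
  exact ⟨n + 1, by rw [zpow_mul_unit_mem_fracIdeal hϖ]; omega⟩

theorem exists_mem_fracIdeal (x : K) : ∃ n : ℕ, x ∈ fracIdeal ϖ (-n) := by
  by_cases hx : x = 0
  · exact ⟨0, by rw [hx]; exact zero_mem _⟩
  obtain ⟨n, u, rfl⟩ := exists_eq_zpow_mul_unit hϖ hx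
  exact ⟨n.natAbs, by rw [zpow_mul_unit_mem_fracIdeal hϖ]; omega⟩

end Arithmetic


/-! ### Maximal orders as stabilisers of lattices -/

section Orders

variable {K : Type*} [Field K]

/-- The matrix `g⁻¹ x g` of `x` in the basis given by the columns of `g`. -/
def coords (g : GL (Fin 2) K) :
    Matrix (Fin 2) (Fin 2) K ≃ₐ[K] Matrix (Fin 2) (Fin 2) K where
  toFun x := (↑g⁻¹ : Matrix (Fin 2) (Fin 2) K) * x * (g : Matrix (Fin 2) (Fin 2) K)
  invFun x := (g : Matrix (Fin 2) (Fin 2) K) * x * (↑g⁻¹ : Matrix (Fin 2) (Fin 2) K)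
  left_inv x := by
    simp only [← mul_assoc, Units.mul_inv, one_mul]
    simp only [mul_assoc, Units.mul_inv, mul_one]
  right_inv x := by
    simp only [← mul_assoc, Units.inv_mul, one_mul]
    simp only [mul_assoc, Units.inv_mul, mul_one]
  map_mul' x y := by
    simp only [mul_assoc]
    rw [← mul_assoc (g : Matrix (Fin 2) (Fin 2) K) _ (y * _), Units.mul_inv, one_mul]
  map_add' x y := by simp only [mul_add, add_mul]
  commutes' c := by
    rw [← Algebra.commutes, mul_assoc, Units.inv_mul, mul_one]

theorem coords_apply (g : GL (Fin 2) K) (x : Matrix (Fin 2) (Fin 2) K) :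
    coords g x = (↑g⁻¹ : Matrix (Fin 2) (Fin 2) K) * x * (g : Matrix (Fin 2) (Fin 2) K) := rfl

theorem coords_mul (g h : GL (Fin 2) K) (x : Matrix (Fin 2) (Fin 2) K) :
    coords (g * h) x = coords h (coords g x) := by
  simp only [coords_apply, mul_inv_rev, Units.val_mul, mul_assoc]

theorem coords_one (x : Matrix (Fin 2) (Fin 2) K) : coords 1 x = x := by
  simp [coords_apply]

theorem coords_injective (g : GL (Fin 2) K) : Function.Injective (coords g) :=
  (coords g).injective

theorem trace_coords (g : GL (Fin 2) K) (x : Matrix (Fin 2) (Fin 2) K) :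
    (coords g x).trace = x.trace := by
  rw [coords_apply, Matrix.trace_mul_comm, ← mul_assoc, Units.mul_inv, one_mul]

theorem det_coords (g : GL (Fin 2) K) (x : Matrix (Fin 2) (Fin 2) K) :
    (coords g x).det = x.det := by
  rw [coords_apply, Matrix.det_mul_right_comm, Units.inv_mul, one_mul]

variable [ValuativeRel K]

/-- The maximal order of the matrices that are integral in the basis given by `g`. -/
def order (g : GL (Fin 2) K) : Subalgebra 𝒪[K] (Matrix (Fin 2) (Fin 2) K) where
  carrier := {x | ∀ i j, coords g x i j ∈ 𝒪[K]}
  mul_mem' := by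
    intro x y hx hy i j
    rw [map_mul, Matrix.mul_apply]
    exact sum_mem fun k _ => mul_mem (hx i k) (hy k j)
  add_mem' := by
    intro x y hx hy i j
    rw [map_add, Matrix.add_apply]
    exact add_mem (hx i j) (hy i j)
  algebraMap_mem' := by
    intro c i j
    rw [IsScalarTower.algebraMap_apply 𝒪[K] K, AlgEquiv.commutes, Matrix.algebraMap_matrix_apply]
    split_ifs
    · exact c.2
    · exact zero_mem _

theorem mem_order {g : GL (Fin 2) K} {x : Matrix (Fin 2) (Fin 2) K} :
    x ∈ order g ↔ ∀ i j, coords g x i j ∈ 𝒪[K] := Iff.rfl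

theorem mem_order_mul {g h : GL (Fin 2) K} {x : Matrix (Fin 2) (Fin 2) K} :
    x ∈ order (g * h) ↔ coords g x ∈ order h := by
  simp only [mem_order, coords_mul]

theorem trace_mem_integers {g : GL (Fin 2) K} {x : Matrix (Fin 2) (Fin 2) K} (hx : x ∈ order g) :
    x.trace ∈ 𝒪[K] := by
  rw [← trace_coords g]
  exact sum_mem fun i _ => hx i i

theorem det_mem_integers {g : GL (Fin 2) K} {x : Matrix (Fin 2) (Fin 2) K} (hx : x ∈ order g) :
    x.det ∈ 𝒪[K] := by
  rw [← det_coords g, Matrix.det_fin_two]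
  exact sub_mem (mul_mem (hx _ _) (hx _ _)) (mul_mem (hx _ _) (hx _ _))

/-- Trace duality: multiplying by the matrix unit e_{ji} and taking the trace reads off the (i, j)
entry, and elements of `order h` have integral trace. -/
theorem order_eq_of_le {g h : GL (Fin 2) K} (hle : order g ≤ order h) : order h = order g := by
  refine le_antisymm (fun x hx i j => ?_) hle
  have hy : (coords g).symm (Matrix.single j i 1) ∈ order g := by
    intro a b
    rw [AlgEquiv.apply_symm_apply, Matrix.single_apply]
    split_ifs
    · exact one_mem _
    · exact zero_mem _
  have ht := trace_mem_integers (mul_mem hx (hle hy))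
  rw [← trace_coords g, map_mul, AlgEquiv.apply_symm_apply, Matrix.trace_mul_single] at ht
  simpa using ht

theorem isOrder_order (g : GL (Fin 2) K) : IsOrder (order g) := by
  let ι : Matrix (Fin 2) (Fin 2) 𝒪[K] →ₗ[𝒪[K]] Matrix (Fin 2) (Fin 2) K :=
    ((coords g).symm.toLinearMap.restrictScalars 𝒪[K]) ∘ₗ
      (Algebra.linearMap 𝒪[K] K).mapMatrix
  have h : Subalgebra.toSubmodule (order g) = LinearMap.range ι := by
    ext x
    rw [Subalgebra.mem_toSubmodule, LinearMap.mem_range]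
    constructor
    · intro hx
      refine ⟨Matrix.of fun i j => ⟨coords g x i j, hx i j⟩, ?_⟩
      apply coords_injective g
      simp only [ι, LinearMap.comp_apply, LinearMap.restrictScalars_apply,
        AlgEquiv.toLinearMap_apply, AlgEquiv.apply_symm_apply]
      ext i j
      rfl
    · rintro ⟨M, rfl⟩ i j
      simp only [ι, LinearMap.comp_apply, LinearMap.restrictScalars_apply,
        AlgEquiv.toLinearMap_apply, AlgEquiv.apply_symm_apply]
      exact (M i j).2
  rw [IsOrder, h, LinearMap.range_eq_map]
  exact Submodule.FG.map _ Module.Finite.fg_top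

variable [TopologicalSpace K] [IsNonarchimedeanLocalField K]

/-- H stabilises the lattice Λ = H·e₀ + H·e₁. Over a discrete valuation ring Λ is free of rank 2,
and in a basis of Λ all of H is integral. -/
theorem exists_le_order {H : Subalgebra 𝒪[K] (Matrix (Fin 2) (Fin 2) K)} (hH : IsOrder H) :
    ∃ g, H ≤ order g := by
  let ev (v : Fin 2 → K) : Matrix (Fin 2) (Fin 2) K →ₗ[𝒪[K]] (Fin 2 → K) :=
    { toFun := fun x => x.mulVec v
      map_add' := fun x y => Matrix.add_mulVec x y v
      map_smul' := fun c x => Matrix.smul_mulVec c x v }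
  let Λ : Submodule 𝒪[K] (Fin 2 → K) :=
    ⨆ i : Fin 2, (Subalgebra.toSubmodule H).map (ev (Pi.single i 1))
  have hstab : ∀ x ∈ H, ∀ v ∈ Λ, x.mulVec v ∈ Λ := by
    intro x hx v hv
    let m : (Fin 2 → K) →ₗ[𝒪[K]] (Fin 2 → K) := (Matrix.mulVecLin x).restrictScalars 𝒪[K]
    have : Λ ≤ Λ.comap m := by
      refine iSup_le fun i => ?_
      rintro _ ⟨y, hy, rfl⟩
      refine Submodule.mem_iSup_of_mem i ⟨x * y, H.mul_mem hx hy, ?_⟩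
      exact (Matrix.mulVec_mulVec _ x y).symm
    exact this hv
  have hfg : Λ.FG := Submodule.fg_iSup _ fun i => hH.map _
  have hlat : Submodule.IsLattice K Λ := by
    refine ⟨hfg, ?_⟩
    rw [eq_top_iff, ← (Pi.basisFun K (Fin 2)).span_eq, Submodule.span_le]
    rintro _ ⟨i, rfl⟩
    refine Submodule.subset_span (Submodule.mem_iSup_of_mem i ⟨1, H.one_mem, ?_⟩)
    exact (Matrix.one_mulVec _).trans (Pi.basisFun_apply K (Fin 2) i).symm
  have : Module.Free 𝒪[K] Λ := Submodule.IsLattice.free (K := K) Λ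
  have hrank : Module.finrank 𝒪[K] Λ = 2 := by
    simpa using Submodule.IsLattice.finrank_of_pi (K := K) Λ
  let b : Module.Basis (Fin 2) 𝒪[K] Λ := Module.finBasisOfFinrankEq _ _ hrank
  let B := b.extendOfIsLattice K
  let e := Pi.basisFun K (Fin 2)
  let g : GL (Fin 2) K :=
    ⟨e.toMatrix B, B.toMatrix e, e.toMatrix_mul_toMatrix_flip B, B.toMatrix_mul_toMatrix_flip e⟩
  refine ⟨g, fun x hx i j => ?_⟩
  have hg : coords g x i j = B.repr (x.mulVec (B j)) i := by
    have h1 : coords g x = LinearMap.toMatrix B B (Matrix.toLin e e x) := by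
      rw [coords_apply, ← basis_toMatrix_mul_linearMap_toMatrix_mul_basis_toMatrix B e B e,
        LinearMap.toMatrix_toLin]
      rfl
    rw [h1, LinearMap.toMatrix_apply, Matrix.toLin_eq_toLin', Matrix.toLin'_apply]
  have hBj : B j = (b j : Fin 2 → K) := Module.Basis.extendOfIsLattice_apply K b j
  obtain ⟨w, hw⟩ : ∃ w : Λ, (w : Fin 2 → K) = x.mulVec (B j) :=
    ⟨⟨_, hstab x hx _ (by rw [hBj]; exact (b j).2)⟩, rfl⟩
  have hsum : (w : Fin 2 → K) = ∑ k, ((b.repr w k : 𝒪[K]) : K) • B k := by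
    conv_lhs => rw [← b.sum_repr w]
    rw [Submodule.coe_sum]
    refine Finset.sum_congr rfl fun k _ => ?_
    rw [Module.Basis.extendOfIsLattice_apply K b k]
    rfl
  rw [hg, ← hw, hsum, B.repr_sum_self]
  exact (b.repr w i).2

theorem isMaximalOrder_order (g : GL (Fin 2) K) : IsMaximalOrder (order g) := by
  refine ⟨isOrder_order g, fun H hH hle => ?_⟩
  obtain ⟨h, hh⟩ := exists_le_order hH
  rw [← order_eq_of_le (hle.trans hh)]
  exact hh

/-- The vertex of the tree given by a basis of `K²`. -/
def vertex (g : GL (Fin 2) K) : Vertex K := ⟨order g, isMaximalOrder_order g⟩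

theorem vertex_surjective : Function.Surjective (vertex (K := K)) := by
  rintro ⟨D, hD⟩
  obtain ⟨g, hg⟩ := exists_le_order hD.prop
  exact ⟨g, Subtype.ext (hD.eq_of_le (isOrder_order g) hg).symm⟩

theorem vertex_eq_iff {g h : GL (Fin 2) K} : vertex g = vertex h ↔ order g = order h :=
  Subtype.ext_iff

end Orders


/-! ### Invariant factors and the relative position of two vertices -/

section RelativePosition

variable {K : Type*} [Field K] [ValuativeRel K]

theorem mem_integers_of_mul_integral {N y z : Matrix (Fin 2) (Fin 2) K}
    (hN : ∀ i j, N i j ∈ 𝒪[K]) (hd : N.det⁻¹ ∈ 𝒪[K]) (h0 : N.det ≠ 0)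
    (hz : ∀ i j, z i j ∈ 𝒪[K]) (e : N * y = z * N) : ∀ i j, y i j ∈ 𝒪[K] := by
  have hy : y = N.det⁻¹ • (N.adjugate * (z * N)) := by
    rw [← e, ← mul_assoc, Matrix.adjugate_mul, Matrix.smul_mul, one_mul, smul_smul,
      inv_mul_cancel₀ h0, one_smul]
  have hadj : ∀ i j, N.adjugate i j ∈ 𝒪[K] := by
    rw [Matrix.adjugate_fin_two]
    intro i j
    fin_cases i <;> fin_cases j
    · exact hN 1 1
    · exact neg_mem (hN 0 1)
    · exact neg_mem (hN 1 0)
    · exact hN 0 0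
  intro i j
  rw [hy, Matrix.smul_apply, smul_eq_mul, Matrix.mul_apply]
  refine mul_mem hd (sum_mem fun k _ => mul_mem (hadj i k) ?_)
  rw [Matrix.mul_apply]
  exact sum_mem fun l _ => mul_mem (hz k l) (hN l j)

/-- The order depends only on the homothety class of the lattice spanned by the columns. One
inclusion suffices, by `order_eq_of_le`. -/
theorem order_eq_of_eq_smul_mul {g h : GL (Fin 2) K} {a : K} {N : Matrix (Fin 2) (Fin 2) K}
    (hN : ∀ i j, N i j ∈ 𝒪[K]) (hd : N.det⁻¹ ∈ 𝒪[K])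
    (e : (h : Matrix (Fin 2) (Fin 2) K) = a • ((g : Matrix (Fin 2) (Fin 2) K) * N)) :
    order h = order g := by
  have hdet : (h : Matrix (Fin 2) (Fin 2) K).det ≠ 0 := h.det_ne_zero
  rw [e, Matrix.det_smul, Matrix.det_mul] at hdet
  have ha : a ≠ 0 := by
    rintro rfl
    simp at hdet
  have h0 : N.det ≠ 0 := right_ne_zero_of_mul (right_ne_zero_of_mul hdet)
  refine order_eq_of_le fun x hx => ?_
  refine mem_integers_of_mul_integral hN hd h0 hx ?_
  have h1 : (h : Matrix (Fin 2) (Fin 2) K) * coords h x = x * h := by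
    rw [coords_apply, ← mul_assoc, ← mul_assoc, Units.mul_inv, one_mul]
  have h2 : (g : Matrix (Fin 2) (Fin 2) K) * coords g x = x * g := by
    rw [coords_apply, ← mul_assoc, ← mul_assoc, Units.mul_inv, one_mul]
  rw [e, Matrix.smul_mul, Matrix.mul_smul] at h1
  have h3 := smul_right_injective _ ha h1
  simp only [mul_assoc] at h3
  rw [← mul_assoc x, ← h2, mul_assoc] at h3
  exact g.isUnit.mul_left_cancel h3

variable {ϖ : 𝒪[K]} (hϖ : Irreducible ϖ)

/-- The diagonal matrix with entries `1` and `ϖ ^ n`. -/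
def shift (n : ℤ) : GL (Fin 2) K where
  val := !![1, 0; 0, (ϖ : K) ^ n]
  inv := !![1, 0; 0, (ϖ : K) ^ (-n)]
  val_inv := by
    have := uniformizer_ne_zero hϖ
    ext i j
    fin_cases i <;> fin_cases j <;> simp [zpow_ne_zero, this]
  inv_val := by
    have := uniformizer_ne_zero hϖ
    ext i j
    fin_cases i <;> fin_cases j <;> simp [zpow_ne_zero, this]

theorem coe_shift (n : ℤ) :
    (shift hϖ n : Matrix (Fin 2) (Fin 2) K) = !![1, 0; 0, (ϖ : K) ^ n] := rfl

theorem shift_zero : shift hϖ 0 = 1 := by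
  ext i j
  fin_cases i <;> fin_cases j <;> simp [coe_shift]

theorem shift_mul (m n : ℤ) : shift hϖ m * shift hϖ n = shift hϖ (m + n) := by
  ext i j
  rw [Units.val_mul]
  simp only [coe_shift, zpow_add₀ (uniformizer_ne_zero hϖ)]
  fin_cases i <;> fin_cases j <;> simp

theorem coords_shift (n : ℤ) (x : Matrix (Fin 2) (Fin 2) K) :
    coords (shift hϖ n) x =
      !![x 0 0, (ϖ : K) ^ n * x 0 1; (ϖ : K) ^ (-n) * x 1 0, x 1 1] := by
  have := uniformizer_ne_zero hϖ
  have e : (↑(shift hϖ n)⁻¹ : Matrix (Fin 2) (Fin 2) K) = !![1, 0; 0, (ϖ : K) ^ (-n)] := rfl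
  conv_lhs => rw [coords_apply, e, coe_shift, Matrix.eta_fin_two x, Matrix.mul_fin_two,
    Matrix.mul_fin_two]
  ext i j
  fin_cases i <;> fin_cases j <;> simp [mul_comm, this, zpow_ne_zero]

theorem mem_order_mul_shift {g : GL (Fin 2) K} {n : ℤ} {x : Matrix (Fin 2) (Fin 2) K} :
    x ∈ order (g * shift hϖ n) ↔ coords g x 0 0 ∈ 𝒪[K] ∧ coords g x 0 1 ∈ fracIdeal ϖ (-n) ∧
      coords g x 1 0 ∈ fracIdeal ϖ n ∧ coords g x 1 1 ∈ 𝒪[K] := by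
  rw [mem_order_mul, mem_order]
  simp only [Fin.forall_fin_two, coords_shift]
  simp only [Matrix.of_apply, Matrix.cons_val_zero, Matrix.cons_val_one, ← mem_fracIdeal_zero (ϖ := ϖ),
    zpow_mul_mem_fracIdeal hϖ, zero_sub, neg_neg]
  simp [and_assoc]

/-- The antidiagonal permutation matrix. -/
def swap : GL (Fin 2) K where
  val := !![0, 1; 1, 0]
  inv := !![0, 1; 1, 0]
  val_inv := by ext i j; fin_cases i <;> fin_cases j <;> simp
  inv_val := by ext i j; fin_cases i <;> fin_cases j <;> simp

omit [ValuativeRel K] in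
theorem coe_swap : ((swap : GL (Fin 2) K) : Matrix (Fin 2) (Fin 2) K) = !![0, 1; 1, 0] := rfl

/-- The invertible matrices over `𝒪[K]`. -/
def IsIntegralUnit (N : Matrix (Fin 2) (Fin 2) K) : Prop :=
  (∀ i j, N i j ∈ 𝒪[K]) ∧ N.det⁻¹ ∈ 𝒪[K]

theorem IsIntegralUnit.mul {M N : Matrix (Fin 2) (Fin 2) K} (hM : IsIntegralUnit M)
    (hN : IsIntegralUnit N) : IsIntegralUnit (M * N) := by
  refine ⟨fun i j => ?_, ?_⟩
  · rw [Matrix.mul_apply]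
    exact sum_mem fun k _ => mul_mem (hM.1 i k) (hN.1 k j)
  · rw [Matrix.det_mul, mul_inv]
    exact mul_mem hM.2 hN.2

theorem isIntegralUnit_swap : IsIntegralUnit ((swap : GL (Fin 2) K) : Matrix (Fin 2) (Fin 2) K) := by
  refine ⟨fun i j => ?_, ?_⟩
  · rw [coe_swap]
    fin_cases i <;> fin_cases j <;> simp
  · simp [coe_swap, Matrix.det_fin_two]

theorem isIntegralUnit_of_det_eq {N : Matrix (Fin 2) (Fin 2) K} (u : 𝒪[K]ˣ)
    (hN : ∀ i j, N i j ∈ 𝒪[K]) (h : N.det = (u : 𝒪[K])) : IsIntegralUnit N := by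
  refine ⟨hN, ?_⟩
  have : ((u : 𝒪[K]) : K)⁻¹ = ((u⁻¹ : 𝒪[K]ˣ) : 𝒪[K]) := by
    apply inv_eq_of_mul_eq_one_right
    exact_mod_cast u.mul_inv
  rw [h, this]
  exact SetLike.coe_mem _

theorem integral_fin_two {a b c d : K} (ha : a ∈ 𝒪[K]) (hb : b ∈ 𝒪[K]) (hc : c ∈ 𝒪[K])
    (hd : d ∈ 𝒪[K]) (i j : Fin 2) : !![a, b; c, d] i j ∈ 𝒪[K] := by
  fin_cases i <;> fin_cases j <;> simpa

variable [TopologicalSpace K] [IsNonarchimedeanLocalField K]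

/-- The matrix `M` has a Smith normal form. -/
def HasSmithForm (hϖ : Irreducible ϖ) (M : Matrix (Fin 2) (Fin 2) K) : Prop :=
  ∃ (a : K) (P Q : Matrix (Fin 2) (Fin 2) K) (n : ℕ), IsIntegralUnit P ∧ IsIntegralUnit Q ∧
    M = a • (P * shift hϖ n * Q)

/-- Elimination with the corner entry as pivot leaves d - bc in the opposite corner, and this is ϖ^n
times a unit. -/
theorem hasSmithForm_of_dvd {M : Matrix (Fin 2) (Fin 2) K} (hM : M.det ≠ 0)
    (h : ∀ i j, ∃ c ∈ 𝒪[K], M i j = c * M 0 0) : HasSmithForm hϖ M := by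
  obtain ⟨b, hb, eb⟩ := h 0 1
  obtain ⟨c, hc, ec⟩ := h 1 0
  obtain ⟨d, hd, ed⟩ := h 1 1
  have hδ : d - b * c ≠ 0 := by
    intro h0
    apply hM
    rw [Matrix.det_fin_two, eb, ec, ed]
    linear_combination M 0 0 ^ 2 * h0
  obtain ⟨n, u, hu⟩ := exists_eq_zpow_mul_unit hϖ hδ
  have hn : 0 ≤ n := by
    rw [← zpow_mul_unit_mem_fracIdeal hϖ u, ← hu, mem_fracIdeal_zero]
    exact sub_mem hd (mul_mem hb hc)
  lift n to ℕ using hn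
  refine ⟨M 0 0, !![1, 0; c, 1], !![1, b; 0, (u : 𝒪[K])], n,
    isIntegralUnit_of_det_eq 1 (integral_fin_two (one_mem _) (zero_mem _) hc (one_mem _))
      (by simp [Matrix.det_fin_two]),
    isIntegralUnit_of_det_eq u (integral_fin_two (one_mem _) hb (zero_mem _) (SetLike.coe_mem _))
      (by simp [Matrix.det_fin_two]), ?_⟩
  have e : d = (ϖ : K) ^ (n : ℤ) * ((u : 𝒪[K]) : K) + b * c := by rw [← hu]; ring
  rw [coe_shift]
  ext i j
  fin_cases i <;> fin_cases j
  · simp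
  · simp [eb]; ring
  · simp [ec]; ring
  · simp only [Fin.mk_one, Fin.isValue, ed, e]
    simp
    ring

omit [TopologicalSpace K] [IsNonarchimedeanLocalField K] in
theorem hasSmithForm_swap_mul {M : Matrix (Fin 2) (Fin 2) K}
    (h : HasSmithForm hϖ ((swap : GL (Fin 2) K) * M)) : HasSmithForm hϖ M := by
  obtain ⟨a, P, Q, n, hP, hQ, e⟩ := h
  refine ⟨a, (swap : GL (Fin 2) K) * P, Q, n, isIntegralUnit_swap.mul hP, hQ, ?_⟩
  rw [mul_assoc, mul_assoc, ← mul_assoc P, ← Matrix.mul_smul, ← e, ← mul_assoc]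
  have : ((swap : GL (Fin 2) K) : Matrix (Fin 2) (Fin 2) K) * (swap : GL (Fin 2) K) = 1 :=
    Units.mul_inv _
  rw [this, one_mul]

omit [TopologicalSpace K] [IsNonarchimedeanLocalField K] in
theorem hasSmithForm_mul_swap {M : Matrix (Fin 2) (Fin 2) K}
    (h : HasSmithForm hϖ (M * (swap : GL (Fin 2) K))) : HasSmithForm hϖ M := by
  obtain ⟨a, P, Q, n, hP, hQ, e⟩ := h
  refine ⟨a, P, Q * (swap : GL (Fin 2) K), n, hP, hQ.mul isIntegralUnit_swap, ?_⟩
  rw [← mul_assoc, ← Matrix.smul_mul, ← e, mul_assoc]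
  have : ((swap : GL (Fin 2) K) : Matrix (Fin 2) (Fin 2) K) * (swap : GL (Fin 2) K) = 1 :=
    Units.mul_inv _
  rw [this, mul_one]

omit [TopologicalSpace K] [IsNonarchimedeanLocalField K] in
theorem exists_dvd_entry (M : Matrix (Fin 2) (Fin 2) K) :
    ∃ i₀ j₀, ∀ i j, ∃ c ∈ 𝒪[K], M i j = c * M i₀ j₀ := by
  obtain ⟨p, -, hp⟩ := Finset.exists_max_image Finset.univ
    (fun p : Fin 2 × Fin 2 => ValuativeRel.valuation K (M p.1 p.2)) Finset.univ_nonempty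
  refine ⟨p.1, p.2, fun i j => ?_⟩
  have := hp (i, j) (Finset.mem_univ _)
  by_cases h0 : M p.1 p.2 = 0
  · refine ⟨0, zero_mem _, ?_⟩
    rw [h0, map_zero] at this
    simpa using this
  · refine ⟨M i j / M p.1 p.2, ?_, by field_simp⟩
    rw [Valuation.mem_integer_iff, map_div₀]
    exact div_le_one_of_le₀ this zero_le

/-- An entry of largest valuation divides all the others; row and column swaps carry it to the
corner. -/
theorem hasSmithForm {M : Matrix (Fin 2) (Fin 2) K} (hM : M.det ≠ 0) : HasSmithForm hϖ M := by
  have hs : ((swap : GL (Fin 2) K) : Matrix (Fin 2) (Fin 2) K).det ≠ 0 :=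
    (swap : GL (Fin 2) K).det_ne_zero
  have hl : ∀ (M : Matrix (Fin 2) (Fin 2) K) j,
      ((swap : GL (Fin 2) K) * M) 0 j = M 1 j ∧ ((swap : GL (Fin 2) K) * M) 1 j = M 0 j := by
    intro M j
    simp [coe_swap, Matrix.mul_apply]
  have hr : ∀ (M : Matrix (Fin 2) (Fin 2) K) i,
      (M * (swap : GL (Fin 2) K)) i 0 = M i 1 ∧ (M * (swap : GL (Fin 2) K)) i 1 = M i 0 := by
    intro M i
    simp [coe_swap, Matrix.mul_apply]
  obtain ⟨i₀, j₀, h⟩ := exists_dvd_entry M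
  have hcol : ∀ M : Matrix (Fin 2) (Fin 2) K, M.det ≠ 0 →
      (∃ j₀, ∀ i j, ∃ c ∈ 𝒪[K], M i j = c * M 0 j₀) → HasSmithForm hϖ M := by
    rintro M hM ⟨j₀, h⟩
    fin_cases j₀
    · exact hasSmithForm_of_dvd hϖ hM h
    · refine hasSmithForm_mul_swap hϖ (hasSmithForm_of_dvd hϖ ?_ ?_)
      · rw [Matrix.det_mul]
        exact mul_ne_zero hM hs
      · simp only [Fin.forall_fin_two, hr] at h ⊢
        tauto
  fin_cases i₀
  · exact hcol M hM ⟨j₀, h⟩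
  · refine hasSmithForm_swap_mul hϖ (hcol _ ?_ ⟨j₀, ?_⟩)
    · rw [Matrix.det_mul]
      exact mul_ne_zero hs hM
    · simp only [Fin.forall_fin_two, hl] at h ⊢
      tauto

omit [ValuativeRel K] [TopologicalSpace K] [IsNonarchimedeanLocalField K] in
theorem exists_gl_of_det_ne_zero {P : Matrix (Fin 2) (Fin 2) K} (hP : P.det ≠ 0) :
    ∃ p : GL (Fin 2) K, (p : Matrix (Fin 2) (Fin 2) K) = P :=
  ⟨Matrix.GeneralLinearGroup.mkOfDetNeZero P hP, rfl⟩

/-- In the Smith form a·P·shift·Q of g⁻¹h, the factors a and Q do not change the homothety class of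
the lattice, so only P and the shift remain. -/
theorem exists_relative_position_mul (g : GL (Fin 2) K) (w : Vertex K) :
    ∃ (p : GL (Fin 2) K) (n : ℕ), IsIntegralUnit (p : Matrix (Fin 2) (Fin 2) K) ∧
      w = vertex (g * p * shift hϖ n) := by
  obtain ⟨h, rfl⟩ := vertex_surjective w
  obtain ⟨a, P, Q, n, hP, hQ, e⟩ := hasSmithForm hϖ (g⁻¹ * h).det_ne_zero
  have hdet : ((g⁻¹ * h : GL (Fin 2) K) : Matrix (Fin 2) (Fin 2) K).det ≠ 0 :=
    (g⁻¹ * h).det_ne_zero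
  rw [e, Matrix.det_smul, Matrix.det_mul, Matrix.det_mul] at hdet
  obtain ⟨p, rfl⟩ := exists_gl_of_det_ne_zero (K := K) (P := P) (by
    intro h0
    simp [h0] at hdet)
  refine ⟨p, n, hP, ?_⟩
  rw [vertex_eq_iff]
  refine order_eq_of_eq_smul_mul (a := a) hQ.1 hQ.2 ?_
  rw [Units.val_mul, Units.val_mul, mul_assoc, mul_assoc, ← Matrix.mul_smul,
    ← mul_assoc (p : Matrix (Fin 2) (Fin 2) K), ← e, Units.val_mul, ← mul_assoc, Units.mul_inv,
    one_mul]

theorem vertex_mul_of_isIntegralUnit {p : GL (Fin 2) K} (g : GL (Fin 2) K)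
    (hp : IsIntegralUnit (p : Matrix (Fin 2) (Fin 2) K)) : vertex (g * p) = vertex g := by
  rw [vertex_eq_iff]
  exact order_eq_of_eq_smul_mul (a := 1) hp.1 hp.2 (by rw [one_smul, Units.val_mul])

theorem exists_relative_position (v w : Vertex K) :
    ∃ (g : GL (Fin 2) K) (n : ℕ), v = vertex g ∧ w = vertex (g * shift hϖ n) := by
  obtain ⟨g, rfl⟩ := vertex_surjective v
  obtain ⟨p, n, hp, rfl⟩ := exists_relative_position_mul hϖ g w
  exact ⟨g * p, n, (vertex_mul_of_isIntegralUnit g hp).symm, rfl⟩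

end RelativePosition

/-! ### Adjacency in terms of relative position -/

section Adjacency

variable {K : Type*} [Field K] [ValuativeRel K] {ϖ : 𝒪[K]} (hϖ : Irreducible ϖ)
include hϖ

/-- Inside `order g`, the intersection is cut out by a condition on the lower left entry alone, so
the index is that of ϖ^n 𝒪 in 𝒪. -/
theorem orderIndex_shift (g : GL (Fin 2) K) {n : ℤ} (hn : 0 ≤ n) :
    orderIndex (order g) (order (g * shift hϖ n)) = (fracIdeal ϖ n).relIndex (fracIdeal ϖ 0) := by
  let f : Matrix (Fin 2) (Fin 2) K →+ K ⧸ fracIdeal ϖ n :=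
    { toFun := fun x => QuotientAddGroup.mk (coords g x 1 0)
      map_zero' := by simp
      map_add' := by simp }
  have hf : ∀ x, x ∈ f.ker ↔ coords g x 1 0 ∈ fracIdeal ϖ n := fun x =>
    QuotientAddGroup.eq_zero_iff _
  have h1 : (Subalgebra.toSubmodule (order (g * shift hϖ n))).toAddSubgroup ⊓
      (Subalgebra.toSubmodule (order g)).toAddSubgroup =
        f.ker ⊓ (Subalgebra.toSubmodule (order g)).toAddSubgroup := by
    ext x
    rw [AddSubgroup.mem_inf, AddSubgroup.mem_inf]
    refine and_congr_left fun hx => ?_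
    rw [hf]
    change x ∈ order _ ↔ _
    change x ∈ order _ at hx
    rw [mem_order_mul_shift]
    exact ⟨fun h => h.2.2.1, fun h => ⟨hx 0 0, fracIdeal_anti hϖ (show -n ≤ 0 by omega)
      (mem_fracIdeal_zero.2 (hx 0 1)), h, hx 1 1⟩⟩
  rw [orderIndex, ← AddSubgroup.inf_relIndex_right, h1, AddSubgroup.inf_relIndex_right,
    AddSubgroup.relIndex_ker]
  have h2 := AddSubgroup.relIndex_ker (fracIdeal ϖ 0) (QuotientAddGroup.mk' (fracIdeal ϖ n))
  rw [QuotientAddGroup.ker_mk'] at h2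
  rw [h2]
  congr 2
  ext q
  constructor
  · rintro ⟨x, hx, rfl⟩
    exact ⟨_, mem_fracIdeal_zero.2 (hx 1 0), rfl⟩
  · rintro ⟨x, hx, rfl⟩
    refine ⟨(coords g).symm !![0, 0; x, 0], fun i j => ?_, ?_⟩
    · rw [AlgEquiv.apply_symm_apply]
      exact integral_fin_two (zero_mem _) (zero_mem _) (mem_fracIdeal_zero.1 hx) (zero_mem _) i j
    · simp [f]

variable [TopologicalSpace K] [IsNonarchimedeanLocalField K]

theorem relIndex_fracIdeal_one :
    (fracIdeal ϖ 1).relIndex (fracIdeal ϖ 0) = Nat.card 𝓀[K] := by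
  let f : 𝒪[K] →+ K ⧸ fracIdeal ϖ 1 :=
    (QuotientAddGroup.mk' (fracIdeal ϖ 1)).comp (𝒪[K]).subtype.toAddMonoidHom
  have hf : f.ker = Submodule.toAddSubgroup 𝓂[K] := by
    ext x
    rw [AddMonoidHom.mem_ker]
    refine (QuotientAddGroup.eq_zero_iff _).trans ?_
    change (x : K) ∈ fracIdeal ϖ 1 ↔ x ∈ 𝓂[K]
    rw [hϖ.maximalIdeal_eq, Ideal.mem_span_singleton, mem_fracIdeal]
    refine exists_congr fun y => ?_
    rw [zpow_one]
    exact_mod_cast Iff.rfl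
  have h1 := AddSubgroup.relIndex_ker (fracIdeal ϖ 0) (QuotientAddGroup.mk' (fracIdeal ϖ 1))
  rw [QuotientAddGroup.ker_mk'] at h1
  have h2 := AddSubgroup.index_ker f
  have h3 : f.range = (fracIdeal ϖ 0).map (QuotientAddGroup.mk' (fracIdeal ϖ 1)) := by
    ext q
    constructor
    · rintro ⟨x, rfl⟩
      exact ⟨x, mem_fracIdeal_zero.2 x.2, rfl⟩
    · rintro ⟨x, hx, rfl⟩
      exact ⟨⟨x, mem_fracIdeal_zero.1 hx⟩, rfl⟩
  rw [h1, ← h3, ← h2, hf]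
  rfl

theorem relIndex_fracIdeal_eq_card_iff {n : ℕ} :
    (fracIdeal ϖ n).relIndex (fracIdeal ϖ 0) = Nat.card 𝓀[K] ↔ n = 1 := by
  have h1 := relIndex_fracIdeal_one hϖ
  have hq : 1 < Nat.card 𝓀[K] := Finite.one_lt_card
  refine ⟨fun h => ?_, fun h => h ▸ by simpa using h1⟩
  rcases n with _ | n
  · simp only [Nat.cast_zero, AddSubgroup.relIndex_self] at h
    omega
  · have hm := AddSubgroup.relIndex_mul_relIndex _ _ _
      (fracIdeal_anti hϖ (show (1 : ℤ) ≤ (n + 1 : ℕ) by omega))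
      (fracIdeal_anti hϖ (show (0 : ℤ) ≤ 1 by omega))
    rw [h, h1] at hm
    have h2 : (fracIdeal ϖ (n + 1 : ℕ)).relIndex (fracIdeal ϖ 1) = 1 :=
      Nat.eq_of_mul_eq_mul_right (show 0 < Nat.card 𝓀[K] by omega) (by rw [hm, one_mul])
    rw [AddSubgroup.relIndex_eq_one] at h2
    have := h2 ((zpow_mem_fracIdeal hϖ (r := 1) (s := 1)).2 le_rfl)
    rw [zpow_mem_fracIdeal hϖ] at this
    omega

omit [TopologicalSpace K] [IsNonarchimedeanLocalField K] in
-- This is swap · diag(1, ϖ^n) = ϖ^n · diag(1, ϖ^{-n}) · swap.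
theorem order_mul_swap_mul_shift (g : GL (Fin 2) K) (n : ℤ) :
    order (g * swap * shift hϖ n) = order (g * shift hϖ (-n)) := by
  refine order_eq_of_eq_smul_mul (a := (ϖ : K) ^ n) isIntegralUnit_swap.1
    isIntegralUnit_swap.2 ?_
  rw [Units.val_mul, Units.val_mul, Units.val_mul, mul_assoc, mul_assoc, ← Matrix.mul_smul]
  congr 1
  have := uniformizer_ne_zero hϖ
  ext i j
  fin_cases i <;> fin_cases j <;> simp [coe_swap, coe_shift, this, zpow_ne_zero]

theorem relative_position_symm (g : GL (Fin 2) K) (n : ℤ) :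
    ∃ h : GL (Fin 2) K, vertex (g * shift hϖ n) = vertex h ∧
      vertex g = vertex (h * shift hϖ n) := by
  refine ⟨g * shift hϖ n * swap, (vertex_mul_of_isIntegralUnit _ isIntegralUnit_swap).symm, ?_⟩
  rw [vertex_eq_iff, order_mul_swap_mul_shift, mul_assoc, shift_mul, add_neg_cancel, shift_zero,
    mul_one]

theorem orderIndex_eq_card_iff (g : GL (Fin 2) K) (n : ℕ) :
    orderIndex (vertex g).1 (vertex (g * shift hϖ n)).1 = Nat.card 𝓀[K] ↔ n = 1 := by
  rw [← relIndex_fracIdeal_eq_card_iff hϖ, ← orderIndex_shift hϖ g (Int.natCast_nonneg n)]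
  rfl

theorem adj_vertex_shift (g : GL (Fin 2) K) :
    (tree K).Adj (vertex g) (vertex (g * shift hϖ 1)) := by
  have h := (orderIndex_eq_card_iff hϖ g 1).2 rfl
  refine (SimpleGraph.fromRel_adj _ _ _).2 ⟨fun he => ?_, Or.inl (by simpa using h)⟩
  have hq : 1 < Nat.card 𝓀[K] := Finite.one_lt_card
  rw [Nat.cast_one, ← he, orderIndex, AddSubgroup.relIndex_self] at h
  omega

theorem adj_iff_of_relative_position (g : GL (Fin 2) K) (n : ℕ) :
    (tree K).Adj (vertex g) (vertex (g * shift hϖ n)) ↔ n = 1 := by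
  refine ⟨fun h => ?_, fun h => ?_⟩
  · rcases ((SimpleGraph.fromRel_adj _ _ _).1 h).2 with h | h
    · exact (orderIndex_eq_card_iff hϖ g n).1 h
    · obtain ⟨k, h1, h2⟩ := relative_position_symm hϖ g n
      rw [h1, h2] at h
      exact (orderIndex_eq_card_iff hϖ k n).1 h
  · rw [h]
    exact_mod_cast adj_vertex_shift hϖ g

end Adjacency


/-! ### Neighbours of a vertex as points of the projective line -/

section Neighbors

variable {K : Type*} [Field K]

/-- The unipotent upper triangular matrix with entry `x`. -/
def upper (x : K) : GL (Fin 2) K where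
  val := !![1, x; 0, 1]
  inv := !![1, -x; 0, 1]
  val_inv := by ext i j; fin_cases i <;> fin_cases j <;> simp
  inv_val := by ext i j; fin_cases i <;> fin_cases j <;> simp

theorem coe_upper (x : K) : (upper x : Matrix (Fin 2) (Fin 2) K) = !![1, x; 0, 1] := rfl

theorem coords_upper (x : K) (y : Matrix (Fin 2) (Fin 2) K) :
    coords (upper x) y 0 1 = y 0 1 + x * (y 0 0 - y 1 1) - x * x * y 1 0 := by
  have e : (↑(upper x)⁻¹ : Matrix (Fin 2) (Fin 2) K) = !![1, -x; 0, 1] := rfl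
  conv_lhs => rw [coords_apply, e, coe_upper, Matrix.eta_fin_two y, Matrix.mul_fin_two,
    Matrix.mul_fin_two]
  simp
  ring

variable [ValuativeRel K] {ϖ : 𝒪[K]} (hϖ : Irreducible ϖ)

theorem isIntegralUnit_upper {x : K} (hx : x ∈ 𝒪[K]) :
    IsIntegralUnit (upper x : Matrix (Fin 2) (Fin 2) K) :=
  isIntegralUnit_of_det_eq 1 (integral_fin_two (one_mem _) hx (zero_mem _) (one_mem _))
    (by simp [coe_upper, Matrix.det_fin_two])

/-- Moving the unipotent matrix past the shift replaces x by ϖ^n x, which is integral. -/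
theorem order_mul_upper_mul_shift (g : GL (Fin 2) K) {n : ℤ} {x : K} (hx : x ∈ fracIdeal ϖ (-n)) :
    order (g * upper x * shift hϖ n) = order (g * shift hϖ n) := by
  have := uniformizer_ne_zero hϖ
  have hx' : (ϖ : K) ^ n * x ∈ 𝒪[K] := by
    rw [← mem_fracIdeal_zero (ϖ := ϖ), zpow_mul_mem_fracIdeal hϖ, zero_sub]
    exact hx
  refine order_eq_of_eq_smul_mul (a := 1) (isIntegralUnit_upper hx').1
    (isIntegralUnit_upper hx').2 ?_
  rw [one_smul, Units.val_mul, Units.val_mul, Units.val_mul, mul_assoc, mul_assoc]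
  congr 1
  ext i j
  fin_cases i <;> fin_cases j <;> simp [coe_upper, coe_shift, mul_comm]

variable [TopologicalSpace K] [IsNonarchimedeanLocalField K]

/-- A neighbour is given by a line in the reduction modulo ϖ of the lattice, namely the first column
[x : y] of p. The cases are [1 : 0], when ϖ divides y, and the affine point [x/y : 1], when y is a
unit. -/
theorem neighbor_cases (g : GL (Fin 2) K) {w : Vertex K} (h : (tree K).Adj (vertex g) w) :
    w = vertex (g * shift hϖ 1) ∨ ∃ x ∈ 𝒪[K], w = vertex (g * upper x * shift hϖ (-1)) := by
  have h0 := uniformizer_ne_zero hϖ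
  obtain ⟨p, n, hp, rfl⟩ := exists_relative_position_mul hϖ g w
  rw [← vertex_mul_of_isIntegralUnit g hp, adj_iff_of_relative_position] at h
  subst h
  obtain ⟨hint, hdet⟩ := hp
  have hd0 : (p : Matrix (Fin 2) (Fin 2) K).det ≠ 0 := p.det_ne_zero
  rw [Matrix.det_fin_two] at hdet hd0
  simp only [Fin.forall_fin_two] at hint
  obtain ⟨⟨hx, hz⟩, hy, hw⟩ := hint
  have hpe := Matrix.eta_fin_two (p : Matrix (Fin 2) (Fin 2) K)
  generalize (p : Matrix (Fin 2) (Fin 2) K) 0 0 = x at *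
  generalize (p : Matrix (Fin 2) (Fin 2) K) 0 1 = z at *
  generalize (p : Matrix (Fin 2) (Fin 2) K) 1 0 = y at *
  generalize (p : Matrix (Fin 2) (Fin 2) K) 1 1 = w at *
  by_cases hy1 : y ∈ fracIdeal ϖ 1
  · left
    obtain ⟨y, rfl⟩ := hy1
    rw [zpow_one] at *
    rw [vertex_eq_iff]
    refine order_eq_of_eq_smul_mul (a := 1) (N := !![x, ϖ * z; y, w])
      (integral_fin_two hx (mul_mem ϖ.2 hz) y.2 hw) ?_ ?_
    · convert! hdet using 2
      simp [Matrix.det_fin_two]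
      ring
    · rw [one_smul, Units.val_mul, Units.val_mul, Units.val_mul, mul_assoc, mul_assoc]
      congr 1
      rw [hpe, coe_shift, coe_shift]
      ext i j
      fin_cases i <;> fin_cases j <;> simp [mul_comm]
  · right
    have hy0 : y ≠ 0 := by
      rintro rfl
      exact hy1 (zero_mem _)
    have hyi := inv_mem_integers_of_notMem_fracIdeal hϖ hy hy1
    refine ⟨x * y⁻¹, mul_mem hx hyi, ?_⟩
    rw [vertex_eq_iff]
    refine order_eq_of_eq_smul_mul (a := (ϖ : K)) (N := !![0, z - x * w * y⁻¹; y, ϖ * w])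
      (integral_fin_two (zero_mem _) (sub_mem hz (mul_mem (mul_mem hx hw) hyi)) hy
        (mul_mem ϖ.2 hw)) ?_ ?_
    · convert! hdet using 2
      simp [Matrix.det_fin_two]
      field_simp
      ring
    · rw [Units.val_mul, Units.val_mul, Units.val_mul, Units.val_mul, mul_assoc, mul_assoc,
        mul_assoc, ← Matrix.mul_smul]
      congr 1
      rw [hpe, coe_shift, coe_upper, coe_shift]
      ext i j
      fin_cases i <;> fin_cases j <;> simp
      all_goals field_simp
      ring

theorem exists_vertex_of_adj {v w : Vertex K} (h : (tree K).Adj v w) :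
    ∃ g, v = vertex g ∧ w = vertex (g * shift hϖ 1) := by
  obtain ⟨g, n, rfl, rfl⟩ := exists_relative_position hϖ v w
  rw [adj_iff_of_relative_position] at h
  subst h
  exact ⟨g, rfl, rfl⟩

/-- GL₂(𝒪) acts doubly transitively on the projective line over the residue field, so two distinct
neighbours can be placed on opposite sides of v in one apartment. -/
theorem exists_vertex_of_adj_of_adj {v w w' : Vertex K} (h : (tree K).Adj v w)
    (h' : (tree K).Adj v w') (hne : w ≠ w') :
    ∃ g, v = vertex g ∧ w = vertex (g * shift hϖ 1) ∧ w' = vertex (g * shift hϖ (-1)) := by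
  obtain ⟨g, rfl, rfl⟩ := exists_vertex_of_adj hϖ h
  rcases neighbor_cases hϖ g h' with rfl | ⟨x, hx, rfl⟩
  · exact absurd rfl hne
  · refine ⟨g * upper x, (vertex_mul_of_isIntegralUnit g (isIntegralUnit_upper hx)).symm, ?_, rfl⟩
    rw [vertex_eq_iff, order_mul_upper_mul_shift]
    exact fracIdeal_anti hϖ (show (-1 : ℤ) ≤ 0 by omega) (mem_fracIdeal_zero.2 hx)

end Neighbors

/-! ### The depth of an order in a vertex -/

section Depth

variable {K : Type*} [Field K] [ValuativeRel K]

/-- `H ⊆ K + ϖ ^ r D`, for an arbitrary integer `r`. -/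
def IsDeep (ϖ : 𝒪[K]) (r : ℤ) (H : Subalgebra 𝒪[K] (Matrix (Fin 2) (Fin 2) K)) (D : Vertex K) :
    Prop :=
  ∀ h ∈ H, ∃ c : K, ∃ d ∈ D.1, h = algebraMap K _ c + (ϖ : K) ^ r • d

variable {ϖ : 𝒪[K]} (hϖ : Irreducible ϖ)
  {H : Subalgebra 𝒪[K] (Matrix (Fin 2) (Fin 2) K)}
  [TopologicalSpace K] [IsNonarchimedeanLocalField K]
include hϖ

omit hϖ in
theorem isDeep_vertex {r : ℤ} {g : GL (Fin 2) K} :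
    IsDeep ϖ r H (vertex g) ↔ ∀ h ∈ H, coords g h 0 1 ∈ fracIdeal ϖ r ∧
      coords g h 1 0 ∈ fracIdeal ϖ r ∧ coords g h 0 0 - coords g h 1 1 ∈ fracIdeal ϖ r := by
  refine forall₂_congr fun h _ => ?_
  have hmem : ∀ x : K, x ∈ 𝒪[K] → (ϖ : K) ^ r * x ∈ fracIdeal ϖ r := fun x hx => ⟨⟨x, hx⟩, rfl⟩
  constructor
  · rintro ⟨c, d, hd, rfl⟩
    replace hd : ∀ i j, coords g d i j ∈ 𝒪[K] := hd
    simp only [map_add, map_smul, AlgEquiv.commutes, Matrix.add_apply, Matrix.smul_apply,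
      Matrix.algebraMap_matrix_apply, smul_eq_mul]
    refine ⟨by simpa using hmem _ (hd 0 1), by simpa using hmem _ (hd 1 0), ?_⟩
    have := hmem _ (sub_mem (hd 0 0) (hd 1 1))
    simpa [mul_sub] using this
  · rintro ⟨⟨b, hb⟩, ⟨c, hc⟩, ⟨e, he⟩⟩
    -- Subtracting the lower right entry as a scalar leaves the diagonal difference in the upper
    -- left corner.
    refine ⟨coords g h 1 1, (coords g).symm !![(e : K), b; c, 0], fun i j => ?_, ?_⟩
    · rw [AlgEquiv.apply_symm_apply]
      exact integral_fin_two e.2 b.2 c.2 (zero_mem _) i j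
    · apply coords_injective g
      rw [map_add, map_smul, AlgEquiv.commutes, AlgEquiv.apply_symm_apply]
      ext i j
      fin_cases i <;> fin_cases j
      · simp [Matrix.algebraMap_matrix_apply, ← he]
      · simp [Matrix.algebraMap_matrix_apply, hb]
      · simp [Matrix.algebraMap_matrix_apply, hc]
      · simp [Matrix.algebraMap_matrix_apply]

theorem isDeep_vertex_shift {r n : ℤ} {g : GL (Fin 2) K} :
    IsDeep ϖ r H (vertex (g * shift hϖ n)) ↔ ∀ h ∈ H, coords g h 0 1 ∈ fracIdeal ϖ (r - n) ∧
      coords g h 1 0 ∈ fracIdeal ϖ (r + n) ∧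
      coords g h 0 0 - coords g h 1 1 ∈ fracIdeal ϖ r := by
  rw [isDeep_vertex]
  refine forall₂_congr fun h _ => ?_
  rw [coords_mul, coords_shift]
  simp only [Matrix.of_apply, Matrix.cons_val', Matrix.cons_val_zero, Matrix.cons_val_one,
    Matrix.cons_val_fin_one, zpow_mul_mem_fracIdeal hϖ, sub_neg_eq_add]

theorem IsDeep.mono {r s : ℤ} {D : Vertex K} (h : IsDeep ϖ s H D) (hrs : r ≤ s) :
    IsDeep ϖ r H D := by
  obtain ⟨g, rfl⟩ := vertex_surjective D
  rw [isDeep_vertex] at h ⊢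
  exact fun x hx => ⟨fracIdeal_anti hϖ hrs (h x hx).1, fracIdeal_anti hϖ hrs (h x hx).2.1,
    fracIdeal_anti hϖ hrs (h x hx).2.2⟩

omit hϖ in
-- The scalar from K is automatically integral: the determinant of an element of an order is
-- integral, which makes the scalar a root of a monic integral quadratic.
theorem mem_branch_iff (hH : IsOrder H) {r : ℕ} {D : Vertex K} :
    D ∈ branch ϖ r H ↔ IsDeep ϖ r H D := by
  constructor
  · intro hD h hh
    obtain ⟨c, d, hd, rfl⟩ := hD hh
    refine ⟨c, d, hd, ?_⟩
    rw [zpow_natCast]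
    rfl
  · intro hD h hh
    obtain ⟨c, d, hd, e⟩ := hD h hh
    have hc : c ∈ 𝒪[K] := by
      obtain ⟨g, rfl⟩ := vertex_surjective D
      obtain ⟨g', hg'⟩ := exists_le_order hH
      have htr := trace_mem_integers (hg' hh)
      have hdet := det_mem_integers (hg' hh)
      set a : K := (ϖ : K) ^ (r : ℤ)
      have ha : a ∈ 𝒪[K] := by
        simp only [a, zpow_natCast]
        exact pow_mem ϖ.2 r
      have hd' : ∀ i j, a * coords g d i j ∈ 𝒪[K] := fun i j => mul_mem ha (hd i j)
      have e' : coords g h = algebraMap K _ c + a • coords g d := by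
        rw [e, map_add, map_smul, AlgEquiv.commutes]
      rw [← trace_coords g, e', Matrix.trace_fin_two] at htr
      rw [← det_coords g, e', Matrix.det_fin_two] at hdet
      simp only [Matrix.add_apply, Matrix.smul_apply, Matrix.algebraMap_matrix_apply, smul_eq_mul]
        at htr hdet
      simp at htr hdet
      rcases mem_integers_or_inv c with h | h
      · exact h
      · by_cases h0 : c = 0
        · rw [h0]
          exact zero_mem _
        -- `c` is a root of a monic integral polynomial of degree two.
        have h1 := sub_mem hdet (sub_mem (mul_mem (hd' 0 0) (hd' 1 1))
          (mul_mem (hd' 0 1) (hd' 1 0)))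
        have h2 := sub_mem (mul_mem h h1) (add_mem (hd' 0 0) (hd' 1 1))
        convert! h2 using 1
        field_simp
        ring
    refine ⟨⟨c, hc⟩, d, hd, ?_⟩
    rw [e, zpow_natCast]
    rfl

omit hϖ [TopologicalSpace K] [IsNonarchimedeanLocalField K] in
theorem branch_zero : branch ϖ 0 H = {D | H ≤ D.1} := by
  ext D
  constructor
  · intro hD h hh
    obtain ⟨c, d, hd, rfl⟩ := hD hh
    exact add_mem (D.1.algebraMap_mem c) (D.1.smul_mem hd _)
  · intro hD h hh
    exact ⟨0, h, hD hh, by simp⟩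

/-- At distance n from a vertex containing H the depth is at least -n. A non-scalar element bounds
it from above. -/
theorem exists_depth (hH : IsOrder H) (hs : ∃ h ∈ H, ∀ c : K, h ≠ algebraMap K _ c) :
    ∃ F : Vertex K → ℤ, ∀ D r, r ≤ F D ↔ IsDeep ϖ r H D := by
  have key : ∀ D : Vertex K, ∃ n : ℤ, ∀ r, r ≤ n ↔ IsDeep ϖ r H D := by
    intro D
    have hne : ∃ r, IsDeep ϖ r H D := by
      obtain ⟨g', hg'⟩ := exists_le_order hH
      obtain ⟨g, n, h1, rfl⟩ := exists_relative_position hϖ (vertex g') D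
      rw [vertex_eq_iff] at h1
      rw [h1] at hg'
      refine ⟨-n, ?_⟩
      rw [isDeep_vertex_shift]
      intro h hh
      have hO : ∀ i j, coords g h i j ∈ fracIdeal ϖ 0 := fun i j =>
        mem_fracIdeal_zero.2 (hg' hh i j)
      exact ⟨fracIdeal_anti hϖ (by omega) (hO 0 1), fracIdeal_anti hϖ (by omega) (hO 1 0),
        fracIdeal_anti hϖ (by omega) (sub_mem (hO 0 0) (hO 1 1))⟩
    have hbd : ∃ b : ℤ, ∀ r, IsDeep ϖ r H D → r ≤ b := by
      obtain ⟨g, rfl⟩ := vertex_surjective D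
      obtain ⟨h, hh, hns⟩ := hs
      have : coords g h 0 1 ≠ 0 ∨ coords g h 1 0 ≠ 0 ∨ coords g h 0 0 - coords g h 1 1 ≠ 0 := by
        by_contra! hc
        obtain ⟨h1, h2, h3⟩ := hc
        apply hns (coords g h 1 1)
        apply coords_injective g
        rw [AlgEquiv.commutes]
        ext i j
        rw [Matrix.algebraMap_matrix_apply]
        fin_cases i <;> fin_cases j
        · simpa using sub_eq_zero.1 h3
        · simpa using h1
        · simpa using h2
        · simp
      have aux : ∀ x : K, x ≠ 0 → ∃ b : ℤ, ∀ r, x ∈ fracIdeal ϖ r → r ≤ b := by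
        intro x hx
        obtain ⟨b, hb⟩ := exists_notMem_fracIdeal hϖ hx
        refine ⟨b, fun r hr => ?_⟩
        by_contra hlt
        exact hb (fracIdeal_anti hϖ (by omega) hr)
      rcases this with h | h | h
      all_goals
        obtain ⟨b, hb⟩ := aux _ h
        refine ⟨b, fun r hr => hb r ?_⟩
        have := isDeep_vertex.1 hr _ hh
        tauto
    obtain ⟨n, hn, hmax⟩ := Int.exists_greatest_of_bdd hbd hne
    exact ⟨n, fun r => ⟨fun hr => hn.mono hϖ hr, hmax r⟩⟩
  choose F hF using key
  exact ⟨F, hF⟩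

end Depth

/-! ### The depth is a ridge function -/

section Ridge

/-- The local shape of a function on a tree that increases with unit slope up to a path where it
attains its maximum, if any. -/
structure IsRidge {V : Type*} (G : SimpleGraph V) (F : V → ℤ) : Prop where
  le_add_one : ∀ v w, G.Adj v w → F v ≤ F w + 1
  lt_of_lt : ∀ v w w', G.Adj v w → G.Adj v w' → w ≠ w' → F v < F w → F w' < F v
  lt_of_le_of_le : ∀ v w w' w'', G.Adj v w → G.Adj v w' → G.Adj v w'' → w ≠ w' → w ≠ w'' →
    w' ≠ w'' → F v ≤ F w → F v ≤ F w' → F w'' < F v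

variable {K : Type*} [Field K] [ValuativeRel K] {ϖ : 𝒪[K]} (hϖ : Irreducible ϖ)
  {H : Subalgebra 𝒪[K] (Matrix (Fin 2) (Fin 2) K)}
  [TopologicalSpace K] [IsNonarchimedeanLocalField K]
include hϖ

/-- Place two neighbours at the shifts 1 and -1. The shift 1 controls the lower left entry to one
order more, the shift -1 the upper right one. If the diagonal difference gains an order as well, v
itself is deeper than F v, a contradiction. The gain comes from a strictly deeper neighbour, or from
a third neighbour of depth at least F v. -/
theorem isRidge_depth {F : Vertex K → ℤ} (hF : ∀ D r, r ≤ F D ↔ IsDeep ϖ r H D) :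
    IsRidge (tree K) F where
  le_add_one v w hvw := by
    have h := (hF v (F v)).1 le_rfl
    rw [← sub_le_iff_le_add, hF]
    obtain ⟨g, rfl, rfl⟩ := exists_vertex_of_adj hϖ hvw
    rw [isDeep_vertex] at h
    rw [isDeep_vertex_shift]
    exact fun x hx => ⟨fracIdeal_anti hϖ (by omega) (h x hx).1,
      fracIdeal_anti hϖ (by omega) (h x hx).2.1, fracIdeal_anti hϖ (by omega) (h x hx).2.2⟩
  lt_of_lt v w w' hw hw' hne hlt := by
    by_contra hle
    obtain ⟨g, rfl, rfl, rfl⟩ := exists_vertex_of_adj_of_adj hϖ hw hw' hne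
    have h1 := (hF _ (F (vertex g) + 1)).1 hlt
    have h2 := (hF _ (F (vertex g))).1 (not_lt.1 hle)
    rw [isDeep_vertex_shift] at h1 h2
    have : F (vertex g) + 1 ≤ F (vertex g) := by
      rw [hF, isDeep_vertex]
      exact fun x hx => ⟨fracIdeal_anti hϖ (by omega) (h2 x hx).1,
        fracIdeal_anti hϖ (by omega) (h1 x hx).2.1, (h1 x hx).2.2⟩
    omega
  lt_of_le_of_le v w w' w'' hw hw' hw'' hne hne2 hne3 hle hle' := by
    by_contra hle''
    obtain ⟨g, rfl, rfl, rfl⟩ := exists_vertex_of_adj_of_adj hϖ hw hw' hne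
    have h1 := (hF _ (F (vertex g))).1 hle
    have h2 := (hF _ (F (vertex g))).1 hle'
    have h3 := (hF _ (F (vertex g))).1 (not_lt.1 hle'')
    rcases neighbor_cases hϖ g hw'' with rfl | ⟨x, hx, rfl⟩
    · exact hne2 rfl
    by_cases hx1 : x ∈ fracIdeal ϖ 1
    · refine hne3 ?_
      rw [vertex_eq_iff, order_mul_upper_mul_shift hϖ]
      exact hx1
    have hx0 : x ≠ 0 := by
      rintro rfl
      exact hx1 (zero_mem _)
    have hxinv := inv_mem_integers_of_notMem_fracIdeal hϖ hx hx1
    rw [isDeep_vertex_shift] at h1 h2 h3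
    have : F (vertex g) + 1 ≤ F (vertex g) := by
      rw [hF, isDeep_vertex]
      intro y hy
      have hb := (h2 y hy).1
      have hc := (h1 y hy).2.1
      have h4 := (h3 y hy).1
      rw [coords_mul, coords_upper] at h4
      rw [sub_neg_eq_add] at hb h4
      refine ⟨hb, hc, ?_⟩
      -- The upper right entry at the third neighbour is b + x(a - d) - x²c. Since b, c and this
      -- entry lie in ϖ^(F v + 1) 𝒪 and x is a unit, so does a - d.
      have h5 := integer_mul_mem_fracIdeal hϖ hxinv (sub_mem (add_mem h4
        (integer_mul_mem_fracIdeal hϖ (mul_mem hx hx) hc)) hb)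
      convert h5 using 1
      field_simp
      ring
    omega

end Ridge


/-! ### Ridge functions along non-backtracking walks -/

section RidgeFunctions

variable {V : Type*} {G : SimpleGraph V} {F : V → ℤ} {s : ℕ → V} {n : ℕ}

/-- Once F drops, the vertex just left is higher, so `lt_of_lt` forces another drop; `le_add_one`
makes each drop exactly one. -/
theorem IsRidge.eq_sub_of_lt (hF : IsRidge G F) (hadj : ∀ i < n, G.Adj (s i) (s (i + 1)))
    (hs : ∀ i, i + 2 ≤ n → s i ≠ s (i + 2)) (h : F (s 1) < F (s 0)) :
    ∀ j ≤ n, F (s j) = F (s 0) - j := by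
  have key : ∀ j, j + 1 ≤ n → F (s (j + 1)) < F (s j) := by
    intro j
    induction j with
    | zero => exact fun _ => h
    | succ j ih =>
      intro hj
      exact hF.lt_of_lt _ _ _ (hadj j (by omega)).symm (hadj (j + 1) (by omega))
        (hs j (by omega)) (ih (by omega))
  intro j
  induction j with
  | zero => simp
  | succ j ih =>
    intro hj
    have h1 := ih (by omega)
    have h2 := key j hj
    have h3 := hF.le_add_one _ _ (hadj j (by omega))
    push_cast
    omega

/-- A rise at any step forces, by `lt_of_lt`, a strict rise at the step before it. -/
theorem IsRidge.le_of_le (hF : IsRidge G F) (hadj : ∀ i < n, G.Adj (s i) (s (i + 1)))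
    (hs : ∀ i, i + 2 ≤ n → s i ≠ s (i + 2)) (h : F (s 1) ≤ F (s 0)) :
    ∀ j ≤ n, F (s j) ≤ F (s 0) := by
  have key : ∀ j, j + 1 ≤ n → F (s (j + 1)) ≤ F (s j) := by
    intro j
    induction j with
    | zero => exact fun _ => h
    | succ j ih =>
      intro hj
      by_contra hlt
      have := hF.lt_of_lt _ _ _ (hadj (j + 1) (by omega)) (hadj j (by omega)).symm
        (hs j (by omega)).symm (not_le.1 hlt)
      have := ih (by omega)
      omega
  intro j
  induction j with
  | zero => exact fun _ => le_rfl
  | succ j ih => exact fun hj => (key j hj).trans (ih (by omega))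

/-- Superlevel sets are convex: a walk that starts by dropping has its minimum at the far end, and
otherwise its first vertex may be discarded. -/
theorem IsRidge.le_of_le_ends (hF : IsRidge G F) {k : ℤ} :
    ∀ {n : ℕ} {s : ℕ → V}, (∀ i < n, G.Adj (s i) (s (i + 1))) →
      (∀ i, i + 2 ≤ n → s i ≠ s (i + 2)) → k ≤ F (s 0) → k ≤ F (s n) → ∀ j ≤ n, k ≤ F (s j) := by
  intro n
  induction n with
  | zero =>
    intro s _ _ h0 _ j hj
    rwa [Nat.le_zero.1 hj]
  | succ n ih =>
    intro s hadj hs h0 hn j hj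
    rcases lt_or_ge (F (s 1)) (F (s 0)) with h | h
    · have h1 := hF.eq_sub_of_lt hadj hs h
      have h2 := h1 j hj
      have h3 := h1 (n + 1) le_rfl
      omega
    · cases j with
      | zero => exact h0
      | succ j =>
        exact ih (s := fun i => s (i + 1)) (fun i hi => hadj (i + 1) (by omega))
          (fun i hi => hs (i + 1) (by omega)) (h0.trans h) hn j (by omega)

/-- Below the maximum a walk towards it cannot start level or downwards, so it climbs by one at each
step until it reaches M. -/
theorem IsRidge.exists_eq_max (hF : IsRidge G F) {M : ℤ} (hM : ∀ v, F v ≤ M) :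
    ∀ {n : ℕ} {s : ℕ → V}, (∀ i < n, G.Adj (s i) (s (i + 1))) →
      (∀ i, i + 2 ≤ n → s i ≠ s (i + 2)) → F (s n) = M →
        ∃ j ≤ n, F (s j) = M ∧ (j : ℤ) = M - F (s 0) := by
  intro n
  induction n with
  | zero => exact fun _ _ h => ⟨0, le_rfl, h, by simp [h]⟩
  | succ n ih =>
    intro s hadj hs hn
    by_cases h0 : F (s 0) = M
    · exact ⟨0, by omega, h0, by simp [h0]⟩
    have hlt := lt_of_le_of_ne (hM (s 0)) h0
    have h1 : F (s 0) < F (s 1) := by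
      by_contra h
      have := hF.le_of_le hadj hs (not_lt.1 h) (n + 1) le_rfl
      omega
    obtain ⟨j, hj, hjM, e⟩ := ih (s := fun i => s (i + 1)) (fun i hi => hadj (i + 1) (by omega))
      (fun i hi => hs (i + 1) (by omega)) hn
    have := hF.le_add_one _ _ (hadj 0 (by omega)).symm
    refine ⟨j + 1, by omega, hjM, ?_⟩
    simp only [zero_add] at e this
    push_cast
    omega

theorem _root_.SimpleGraph.Walk.IsPath.getVert_ne_getVert_add_two {v w : V} {p : G.Walk v w}
    (hp : p.IsPath) (i : ℕ) (hi : i + 2 ≤ p.length) : p.getVert i ≠ p.getVert (i + 2) := by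
  intro h
  have := hp.getVert_injOn (show i ∈ {i | i ≤ p.length} by simp; omega)
    (show i + 2 ∈ {i | i ≤ p.length} by simp; omega) h
  omega

theorem IsRidge.le_getVert (hF : IsRidge G F) {k : ℤ} {v w : V} {p : G.Walk v w} (hp : p.IsPath)
    (hv : k ≤ F v) (hw : k ≤ F w) (j : ℕ) : k ≤ F (p.getVert j) := by
  rcases le_total j p.length with hj | hj
  · exact hF.le_of_le_ends (s := p.getVert) (n := p.length) (fun i hi => p.adj_getVert_succ hi)
      hp.getVert_ne_getVert_add_two (by simpa) (by simpa) j hj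
  · rwa [p.getVert_of_length_le hj]

theorem IsRidge.le_add_length (hF : IsRidge G F) {v w : V} (p : G.Walk v w) :
    F w ≤ F v + p.length := by
  induction p with
  | nil => simp
  | cons h p ih =>
    have := hF.le_add_one _ _ h.symm
    rw [SimpleGraph.Walk.length_cons]
    push_cast
    omega

/-- A path from v to a maximal vertex meets the maximal set after M - F v steps; conversely F is
1-Lipschitz. -/
theorem IsRidge.setOf_le_eq (hF : IsRidge G F) (hG : G.Connected) {M : ℤ} (hM : ∀ v, F v ≤ M)
    (hex : ∃ v, F v = M) {k : ℤ} {m : ℕ} (hm : M = k + m) :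
    {v | k ≤ F v} = {v | ∃ w ∈ {w | F w = M}, G.edist v w ≤ m} := by
  ext v
  constructor
  · intro hv
    obtain ⟨w, hw⟩ := hex
    obtain ⟨p, hp⟩ := (hG.preconnected v w).exists_isPath
    obtain ⟨j, hj, hjM, e⟩ := hF.exists_eq_max hM (s := p.getVert) (n := p.length)
      (fun i hi => p.adj_getVert_succ hi)
      hp.getVert_ne_getVert_add_two (by simpa)
    rw [p.getVert_zero] at e
    refine ⟨p.getVert j, hjM, (SimpleGraph.edist_le (p.take j)).trans ?_⟩
    have hv' : k ≤ F v := hv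
    have : (p.take j).length ≤ m := by
      rw [SimpleGraph.Walk.take_length]
      omega
    exact_mod_cast this
  · rintro ⟨w, hw, hd⟩
    have hne : G.edist v w ≠ ⊤ := ne_top_of_le_ne_top (ENat.natCast_ne_top m) hd
    obtain ⟨p, hp⟩ := SimpleGraph.exists_walk_of_edist_ne_top hne
    have h1 := hF.le_add_length p
    rw [← hp] at hd
    have h2 : p.length ≤ m := by exact_mod_cast hd
    have hw' : F w = M := hw
    change k ≤ F v
    omega

/-- Around a cycle based at the peak v the function drops by one at each step, yet returns to its
initial value. -/
theorem isAcyclic_of_isRidge (h : ∀ v, ∃ F : V → ℤ, IsRidge G F ∧ ∀ w, w ≠ v → F w < F v) :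
    G.IsAcyclic := by
  intro v c hc
  obtain ⟨F, hF, hv⟩ := h v
  have h3 := hc.three_le_length
  have hadj : ∀ i < c.length, G.Adj (c.getVert i) (c.getVert (i + 1)) :=
    fun i hi => c.adj_getVert_succ hi
  have h1 := hadj 0 (by omega)
  rw [c.getVert_zero, zero_add] at h1
  have := hF.eq_sub_of_lt hadj (fun i hi => by
    have := hc.getVert_sub_one_ne_getVert_add_one (i := i + 1) (by omega)
    simpa using this) (by simpa using hv _ h1.ne.symm) c.length le_rfl
  simp only [c.getVert_length, c.getVert_zero] at this
  omega

end RidgeFunctions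

/-! ### Convex sets without branching are paths -/

section PathSets

variable {V : Type*} {G : SimpleGraph V} {P : Set V}

theorem getVert_eq_of_getVert_one_eq
    (hdeg : ∀ v ∈ P, ∀ w ∈ P, ∀ w' ∈ P, ∀ w'' ∈ P, G.Adj v w → G.Adj v w' → G.Adj v w'' →
      w ≠ w' → w ≠ w'' → w' = w'')
    {u v w : V} {p : G.Walk u v} {q : G.Walk u w} (hp : p.IsPath) (hq : q.IsPath)
    (hpP : ∀ i, p.getVert i ∈ P) (hqP : ∀ i, q.getVert i ∈ P) (h : p.getVert 1 = q.getVert 1) :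
    ∀ j, j ≤ p.length → j ≤ q.length → p.getVert j = q.getVert j := by
  have key : ∀ j, j + 1 ≤ p.length → j + 1 ≤ q.length →
      p.getVert j = q.getVert j ∧ p.getVert (j + 1) = q.getVert (j + 1) := by
    intro j
    induction j with
    | zero => exact fun _ _ => ⟨by simp, h⟩
    | succ j ih =>
      intro h1 h2
      obtain ⟨e1, e2⟩ := ih (by omega) (by omega)
      have a1 := (p.adj_getVert_succ (i := j) (by omega)).symm
      have a2 := p.adj_getVert_succ (i := j + 1) (by omega)
      have a3 := q.adj_getVert_succ (i := j + 1) (by omega)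
      rw [← e2] at a3
      refine ⟨e2, hdeg _ (hpP (j + 1)) _ (hpP j) _ (hpP _) _ (hqP _) a1 a2 a3
        (hp.getVert_ne_getVert_add_two j (by omega)) ?_⟩
      rw [e1]
      exact hq.getVert_ne_getVert_add_two j (by omega)
  intro j h1 h2
  cases j with
  | zero => simp
  | succ j => exact (key j h1 h2).2

/-- The vertex `v` has signed distance `i` from `v₀`, where the neighbor `a` of `v₀` is on the
positive side. -/
def IsSignedPosition (G : SimpleGraph V) (v₀ a : V) (i : ℤ) (v : V) : Prop :=
  ∃ p : G.Walk v₀ v, p.IsPath ∧ p.length = i.natAbs ∧ (0 < i → p.getVert 1 = a) ∧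
    (i < 0 → p.getVert 1 ≠ a)

theorem IsSignedPosition.exists_between {v₀ a v : V} {i j : ℤ}
    (h : IsSignedPosition G v₀ a i v) (hj : 0 ≤ j ∧ j ≤ i ∨ i ≤ j ∧ j ≤ 0) :
    ∃ k, ∃ p : G.Walk v₀ v, p.IsPath ∧ IsSignedPosition G v₀ a j (p.getVert k) ∧
      (i.natAbs = j.natAbs + 1 → G.Adj (p.getVert k) v) := by
  obtain ⟨p, hp, hl, hpos, hneg⟩ := h
  refine ⟨j.natAbs, p, hp, ⟨p.take j.natAbs, hp.take _, ?_, fun h => ?_, fun h => ?_⟩, ?_⟩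
  · rw [SimpleGraph.Walk.take_length]
    omega
  · rw [SimpleGraph.Walk.take_getVert, min_eq_right (by omega)]
    exact hpos (by omega)
  · rw [SimpleGraph.Walk.take_getVert, min_eq_right (by omega)]
    exact hneg (by omega)
  · intro e
    have := p.adj_getVert_succ (i := j.natAbs) (by omega)
    rwa [← e, ← hl, p.getVert_length] at this

/-- The set is parametrised by signed distance from a base point v₀, a chosen neighbour a marking
the positive side. Absence of branching makes positions determine vertices, uniqueness of paths in a
tree gives the converse, and convexity makes the positions an interval. -/
theorem isPathSet_of_convex (hG : G.IsTree) (hne : P.Nonempty)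
    (hconv : ∀ v ∈ P, ∀ w ∈ P, ∀ p : G.Walk v w, p.IsPath → ∀ i, p.getVert i ∈ P)
    (hdeg : ∀ v ∈ P, ∀ w ∈ P, ∀ w' ∈ P, ∀ w'' ∈ P, G.Adj v w → G.Adj v w' → G.Adj v w'' →
      w ≠ w' → w ≠ w'' → w' = w'') : IsPathSet G P := by
  classical
  obtain ⟨v₀, hv₀⟩ := hne
  obtain ⟨a, ha⟩ : ∃ a, ∀ w ∈ P, G.Adj v₀ w → a ∈ P ∧ G.Adj v₀ a := by
    by_cases h : ∃ a ∈ P, G.Adj v₀ a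
    · obtain ⟨a, ha⟩ := h
      exact ⟨a, fun _ _ _ => ha⟩
    -- Without a neighbour of v₀ in P the condition is vacuous, and any vertex serves.
    · exact ⟨v₀, fun w hw hadj => (h ⟨w, hw, hadj⟩).elim⟩
  have hfun : ∀ i v w, v ∈ P → w ∈ P → IsSignedPosition G v₀ a i v →
      IsSignedPosition G v₀ a i w → v = w := by
    rintro i v w hv hw ⟨p, hp, hpl, hp1, hp2⟩ ⟨q, hq, hql, hq1, hq2⟩
    have hpP := hconv _ hv₀ _ hv p hp
    have hqP := hconv _ hv₀ _ hw q hq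
    rcases eq_or_ne i 0 with rfl | hi
    · rw [← SimpleGraph.Walk.eq_of_length_eq_zero hpl, ← SimpleGraph.Walk.eq_of_length_eq_zero hql]
    have h1 : p.getVert 1 = q.getVert 1 := by
      rcases lt_or_gt_of_ne hi with h | h
      · have ap := p.adj_getVert_succ (i := 0) (by omega)
        have aq := q.adj_getVert_succ (i := 0) (by omega)
        simp only [SimpleGraph.Walk.getVert_zero, zero_add] at ap aq
        obtain ⟨haP, hav⟩ := ha _ (hpP 1) ap
        exact hdeg _ hv₀ _ haP _ (hpP 1) _ (hqP 1) hav ap aq (hp2 h).symm (hq2 h).symm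
      · rw [hp1 h, hq1 h]
    have := getVert_eq_of_getVert_one_eq hdeg hp hq hpP hqP h1 p.length le_rfl (by omega)
    rwa [p.getVert_length, hpl, ← hql, q.getVert_length] at this
  have huniq : ∀ i j v, IsSignedPosition G v₀ a i v → IsSignedPosition G v₀ a j v → i = j := by
    rintro i j v ⟨p, hp, hpl, hp1, hp2⟩ ⟨q, hq, hql, hq1, hq2⟩
    have hpq : p = q := congrArg Subtype.val
      ((hG.isAcyclic.subsingleton_path _ _).elim ⟨p, hp⟩ ⟨q, hq⟩)
    subst hpq
    by_contra hij
    rcases lt_trichotomy i 0 with h | h | h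
    · exact hp2 h (hq1 (by omega))
    · omega
    · exact hq2 (by omega) (hp1 h)
  have htot : ∀ v, ∃ i, IsSignedPosition G v₀ a i v := by
    intro v
    obtain ⟨p, hp⟩ := (hG.connected.preconnected v₀ v).exists_isPath
    by_cases h : p.getVert 1 = a
    · exact ⟨p.length, p, hp, by simp, fun _ => h, fun h => by omega⟩
    · exact ⟨-p.length, p, hp, by simp, fun h => by omega, fun _ => h⟩
  have hbetween : ∀ i v j, v ∈ P → IsSignedPosition G v₀ a i v →
      (0 ≤ j ∧ j ≤ i ∨ i ≤ j ∧ j ≤ 0) →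
      ∃ u ∈ P, IsSignedPosition G v₀ a j u ∧ (i.natAbs = j.natAbs + 1 → G.Adj u v) := by
    intro i v j hv h hj
    obtain ⟨k, p, hp, h1, h2⟩ := h.exists_between hj
    exact ⟨p.getVert k, hconv _ hv₀ _ hv p hp k, h1, h2⟩
  let I : Set ℤ := {i | ∃ v ∈ P, IsSignedPosition G v₀ a i v}
  let f : ℤ → V := fun i => if h : ∃ v ∈ P, IsSignedPosition G v₀ a i v then h.choose else v₀
  have hf : ∀ i ∈ I, f i ∈ P ∧ IsSignedPosition G v₀ a i (f i) := by
    intro i hi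
    have hi' : ∃ v ∈ P, IsSignedPosition G v₀ a i v := hi
    simp only [f, dif_pos hi']
    exact hi'.choose_spec
  refine ⟨I, f, ?_, ⟨?_⟩, ?_, ?_, ?_⟩
  · obtain ⟨i, hi⟩ := htot v₀
    exact ⟨i, v₀, hv₀, hi⟩
  · rintro i ⟨v, hv, hi⟩ j ⟨w, hw, hj⟩ m ⟨h1, h2⟩
    rcases le_total 0 m with hm | hm
    · obtain ⟨u, hu, h, -⟩ := hbetween j w m hw hj (Or.inl ⟨hm, h2⟩)
      exact ⟨u, hu, h⟩
    · obtain ⟨u, hu, h, -⟩ := hbetween i v m hv hi (Or.inr ⟨h1, hm⟩)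
      exact ⟨u, hu, h⟩
  · intro i hi j hj e
    have h1 := (hf i hi).2
    rw [e] at h1
    exact huniq _ _ _ h1 (hf j hj).2
  · intro i hi hi'
    -- The predecessor on the path from v₀ is one step closer to 0: it sits at i for the vertex i +
    -- 1 when i ≥ 0, and at i + 1 for the vertex i when i < 0.
    rcases le_or_gt 0 i with h | h
    · obtain ⟨u, hu, h1, h2⟩ := hbetween _ _ i (hf _ hi').1 (hf _ hi').2 (Or.inl (by omega))
      rw [hfun _ _ _ (hf i hi).1 hu (hf i hi).2 h1]
      exact h2 (by omega)
    · obtain ⟨u, hu, h1, h2⟩ := hbetween _ _ (i + 1) (hf _ hi).1 (hf _ hi).2 (Or.inr (by omega))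
      rw [hfun _ _ _ (hf _ hi').1 hu (hf _ hi').2 h1]
      exact (h2 (by omega)).symm
  · ext v
    constructor
    · intro hv
      obtain ⟨i, hi⟩ := htot v
      have hiI : i ∈ I := ⟨v, hv, hi⟩
      exact ⟨i, hiI, hfun _ _ _ (hf i hiI).1 hv (hf i hiI).2 hi⟩
    · rintro ⟨i, hi, rfl⟩
      exact (hf i hi).1

theorem IsRidge.isPathSet {F : V → ℤ} (hF : IsRidge G F) (hG : G.IsTree) {M : ℤ}
    (hM : ∀ v, F v ≤ M) (hex : ∃ v, F v = M) : IsPathSet G {v | F v = M} := by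
  refine isPathSet_of_convex hG hex (fun v hv w hw p hp i => ?_)
    fun v hv w hw w' hw' w'' hw'' h h' h'' hne hne' => ?_
  · exact le_antisymm (hM _) (hF.le_getVert hp (le_of_eq hv.symm) (le_of_eq hw.symm) i)
  · by_contra hne''
    have := hF.lt_of_le_of_le v w w' w'' h h' h'' hne hne' hne''
    simp only [Set.mem_ofPred_eq] at hv hw hw' hw''
    omega

theorem IsRidge.isThickPath {F : V → ℤ} (hF : IsRidge G F) (hG : G.IsTree) {M : ℤ}
    (hM : ∀ v, F v ≤ M) (hex : ∃ v, F v = M) {k : ℤ} {m : ℕ} (hm : M = k + m) :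
    IsThickPath G m {v | k ≤ F v} :=
  ⟨_, hF.isPathSet hG hM hex, hF.setOf_le_eq hG.connected hM hex hm⟩

end PathSets


/-! ### The graph is an infinite tree -/

section Tree

variable {K : Type*} [Field K] [ValuativeRel K] {ϖ : 𝒪[K]} (hϖ : Irreducible ϖ)
  {H : Subalgebra 𝒪[K] (Matrix (Fin 2) (Fin 2) K)}
  [TopologicalSpace K] [IsNonarchimedeanLocalField K]

theorem IsOrder.mono {H' : Subalgebra 𝒪[K] (Matrix (Fin 2) (Fin 2) K)} (hH : IsOrder H)
    (hle : H' ≤ H) : IsOrder H' :=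
  Submodule.FG.of_le hH hle

theorem isDeep_zero_iff (hH : IsOrder H) {D : Vertex K} : IsDeep ϖ 0 H D ↔ H ≤ D.1 := by
  have h := mem_branch_iff (ϖ := ϖ) hH (r := 0) (D := D)
  rw [branch_zero] at h
  exact h.symm

/-- The idempotent with matrix `diag(1, 0)` in the basis given by `g`. -/
def idem (g : GL (Fin 2) K) : Matrix (Fin 2) (Fin 2) K := (coords g).symm !![1, 0; 0, 0]

omit [ValuativeRel K] [TopologicalSpace K] [IsNonarchimedeanLocalField K] in
theorem coords_idem (g : GL (Fin 2) K) : coords g (idem g) = !![1, 0; 0, 0] :=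
  AlgEquiv.apply_symm_apply _ _

omit [TopologicalSpace K] [IsNonarchimedeanLocalField K] in
theorem idem_mem_order (g : GL (Fin 2) K) : idem g ∈ order g := by
  rw [mem_order, coords_idem]
  exact integral_fin_two (one_mem _) (zero_mem _) (zero_mem _) (zero_mem _)

omit [ValuativeRel K] [TopologicalSpace K] [IsNonarchimedeanLocalField K] in
theorem idem_ne_algebraMap (g : GL (Fin 2) K) (c : K) : idem g ≠ algebraMap K _ c := by
  intro h
  have h1 := coords_idem g
  rw [h, AlgEquiv.commutes] at h1
  have h2 := congrFun (congrFun h1 0) 0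
  have h3 := congrFun (congrFun h1 1) 1
  simp [Matrix.algebraMap_matrix_apply] at h2 h3
  exact one_ne_zero (h2.symm.trans h3)

include hϖ

/-- The idempotent has discriminant 1 = (a - d)² + 4bc in every basis; at depth one the right side
would be divisible by ϖ. -/
theorem not_isDeep_one_of_idem_mem {g : GL (Fin 2) K} (h : idem g ∈ H) (D : Vertex K) :
    ¬ IsDeep ϖ 1 H D := by
  intro hD
  obtain ⟨k, rfl⟩ := vertex_surjective D
  obtain ⟨hb, hc, he⟩ := isDeep_vertex.1 hD _ h
  have htr : (coords k (idem g)).trace = 1 := by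
    rw [trace_coords, ← trace_coords g, coords_idem]
    simp [Matrix.trace_fin_two]
  have hdet : (coords k (idem g)).det = 0 := by
    rw [det_coords, ← det_coords g, coords_idem]
    simp [Matrix.det_fin_two]
  rw [Matrix.trace_fin_two] at htr
  rw [Matrix.det_fin_two] at hdet
  have hc' := mem_fracIdeal_zero.1 (fracIdeal_anti hϖ (show (0 : ℤ) ≤ 1 by omega) hc)
  have he' := mem_fracIdeal_zero.1 (fracIdeal_anti hϖ (show (0 : ℤ) ≤ 1 by omega) he)
  have h4 : (4 : K) ∈ 𝒪[K] := ofNat_mem _ 4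
  refine one_notMem_fracIdeal hϖ one_pos ?_
  have := add_mem (integer_mul_mem_fracIdeal hϖ he' he)
    (integer_mul_mem_fracIdeal hϖ (mul_mem h4 hc') hb)
  convert! this using 1
  linear_combination (-1 - coords k (idem g) 0 0 - coords k (idem g) 1 1) * htr + 4 * hdet

theorem connected_tree : (tree K).Connected := by
  have : Nonempty (Vertex K) := ⟨vertex 1⟩
  refine ⟨fun v w => ?_⟩
  obtain ⟨g, n, rfl, rfl⟩ := exists_relative_position hϖ v w
  induction n with
  | zero => rw [Nat.cast_zero, shift_zero, mul_one]
  | succ n ih =>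
    refine ih.trans ?_
    rw [Nat.cast_succ, ← shift_mul, ← mul_assoc]
    exact (adj_vertex_shift hϖ _).reachable

/-- The depth of a maximal order is nonnegative only at its own vertex, which is therefore a strict
peak. -/
theorem isTree_tree : (tree K).IsTree := by
  refine ⟨connected_tree hϖ, isAcyclic_of_isRidge fun v => ?_⟩
  obtain ⟨g, rfl⟩ := vertex_surjective v
  obtain ⟨F, hF⟩ := exists_depth hϖ (isOrder_order g) ⟨_, idem_mem_order g, idem_ne_algebraMap g⟩
  refine ⟨F, isRidge_depth hϖ hF, fun w hw => ?_⟩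
  by_contra hlt
  have h0 : 0 ≤ F (vertex g) := by
    rw [hF, isDeep_zero_iff (isOrder_order g)]
    exact le_rfl
  have h1 := (hF w 0).1 (h0.trans (not_lt.1 hlt))
  rw [isDeep_zero_iff (isOrder_order g)] at h1
  exact hw (Subtype.ext ((isMaximalOrder_order g).eq_of_le w.2.prop h1).symm)

theorem infinite_vertex : Infinite (Vertex K) := by
  have key : ∀ m n : ℕ, vertex (1 * shift hϖ n) = vertex (1 * shift hϖ m) → n ≤ m := by
    intro m n h
    have h1 : !![0, (ϖ : K) ^ (-(n : ℤ)); 0, 0] ∈ order (1 * shift hϖ n) := by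
      rw [mem_order_mul_shift, coords_one]
      exact ⟨zero_mem _, (zpow_mem_fracIdeal hϖ).2 le_rfl, zero_mem _, zero_mem _⟩
    rw [vertex_eq_iff.1 h, mem_order_mul_shift, coords_one] at h1
    have := (zpow_mem_fracIdeal hϖ).1 h1.2.1
    omega
  exact Infinite.of_injective (fun n : ℕ => vertex (1 * shift hϖ n))
    fun m n h => le_antisymm (key _ _ h) (key _ _ h.symm)

theorem exists_depth_of_not_isDeep (hH : IsOrder H) {r : ℤ} {D : Vertex K}
    (h : ¬ IsDeep ϖ r H D) : ∃ F : Vertex K → ℤ, ∀ D r, r ≤ F D ↔ IsDeep ϖ r H D := by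
  refine exists_depth hϖ hH ?_
  by_contra! hs
  refine h fun x hx => ?_
  obtain ⟨c, rfl⟩ := hs x hx
  exact ⟨c, 0, zero_mem _, by simp⟩

/-- As there are infinitely many vertices, some vertex does not contain H, so H is not scalar. -/
theorem exists_depth_of_finite (hH : IsOrder H) (hfin : {D : Vertex K | H ≤ D.1}.Finite) :
    ∃ F : Vertex K → ℤ, ∀ D r, r ≤ F D ↔ IsDeep ϖ r H D := by
  have := infinite_vertex hϖ
  obtain ⟨D, hD⟩ := hfin.exists_notMem
  refine exists_depth_of_not_isDeep hϖ hH (r := 0) (D := D) ?_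
  rwa [isDeep_zero_iff hH]

omit hϖ in
theorem exists_max_depth_of_finite (hH : IsOrder H) (hfin : {D : Vertex K | H ≤ D.1}.Finite)
    {F : Vertex K → ℤ} (hF : ∀ D r, r ≤ F D ↔ IsDeep ϖ r H D) :
    ∃ v, 0 ≤ F v ∧ ∀ w, F w ≤ F v := by
  have hmem : ∀ D, D ∈ {D : Vertex K | H ≤ D.1} ↔ 0 ≤ F D := fun D => by
    rw [hF, isDeep_zero_iff hH]
    rfl
  obtain ⟨g, hg⟩ := exists_le_order hH
  obtain ⟨v, hv, hmax⟩ := Set.exists_max_image _ F hfin ⟨vertex g, hg⟩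
  rw [hmem] at hv
  refine ⟨v, hv, fun w => ?_⟩
  rcases le_or_gt 0 (F w) with h | h
  · exact hmax w ((hmem w).2 h)
  · omega

end Tree

/-! ### Eichler orders and segments -/

section Eichler

variable {K : Type*} [Field K] [ValuativeRel K] {ϖ : 𝒪[K]} (hϖ : Irreducible ϖ)

omit [ValuativeRel K] in
theorem det_smul_coords (p : GL (Fin 2) K) (y : Matrix (Fin 2) (Fin 2) K) :
    (p : Matrix (Fin 2) (Fin 2) K).det • coords p y =
      (p : Matrix (Fin 2) (Fin 2) K).adjugate * y * p := by
  have h : (p : Matrix (Fin 2) (Fin 2) K).adjugate =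
      (p : Matrix (Fin 2) (Fin 2) K).det • (↑p⁻¹ : Matrix (Fin 2) (Fin 2) K) := by
    rw [← mul_one (Matrix.adjugate _), ← Units.mul_inv p, ← mul_assoc, Matrix.adjugate_mul,
      Matrix.smul_mul, one_mul]
  rw [h, coords_apply, Matrix.smul_mul, Matrix.smul_mul]

theorem order_mul_shift_of_lower_mem (g : GL (Fin 2) K) {p : GL (Fin 2) K}
    (hp : IsIntegralUnit (p : Matrix (Fin 2) (Fin 2) K)) {m : ℕ}
    (h : (p : Matrix (Fin 2) (Fin 2) K) 1 0 ∈ fracIdeal ϖ m) :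
    order (g * p * shift hϖ m) = order (g * shift hϖ m) := by
  have h0 := uniformizer_ne_zero hϖ
  obtain ⟨y, hy⟩ := h
  rw [zpow_natCast] at hy
  obtain ⟨hint, hdet⟩ := hp
  refine order_eq_of_eq_smul_mul (a := 1)
    (N := !![(p : Matrix (Fin 2) (Fin 2) K) 0 0, (ϖ : K) ^ m * (p : Matrix (Fin 2) (Fin 2) K) 0 1;
      (y : K), (p : Matrix (Fin 2) (Fin 2) K) 1 1])
    (integral_fin_two (hint 0 0) (mul_mem (pow_mem ϖ.2 m) (hint 0 1)) y.2 (hint 1 1)) ?_ ?_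
  · convert! hdet using 2
    rw [Matrix.det_fin_two, Matrix.det_fin_two, hy]
    simp
    ring
  · rw [one_smul, Units.val_mul, Units.val_mul, Units.val_mul, mul_assoc, mul_assoc]
    congr 1
    rw [Matrix.eta_fin_two (p : Matrix (Fin 2) (Fin 2) K), coe_shift]
    ext i j
    fin_cases i <;> fin_cases j <;> simp [mul_comm, hy]

theorem order_mul_shift_of_upper_mem (g : GL (Fin 2) K) {p : GL (Fin 2) K}
    (hp : IsIntegralUnit (p : Matrix (Fin 2) (Fin 2) K)) {m : ℕ}
    (h : (p : Matrix (Fin 2) (Fin 2) K) 0 0 ∈ fracIdeal ϖ m) :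
    order (g * p * shift hϖ m) = order (g * shift hϖ (-m)) := by
  have hsp : IsIntegralUnit ((swap * p : GL (Fin 2) K) : Matrix (Fin 2) (Fin 2) K) :=
    isIntegralUnit_swap.mul hp
  have h10 : ((swap * p : GL (Fin 2) K) : Matrix (Fin 2) (Fin 2) K) 1 0 =
      (p : Matrix (Fin 2) (Fin 2) K) 0 0 := by
    simp [coe_swap, Matrix.mul_apply]
  rw [← order_mul_swap_mul_shift, ← order_mul_shift_of_lower_mem hϖ (g * swap) hsp (h10 ▸ h)]
  have : (swap : GL (Fin 2) K) * swap = 1 := Units.ext (Units.mul_inv (swap : GL (Fin 2) K))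
  rw [mul_assoc g swap, ← mul_assoc swap, this, one_mul]

variable [TopologicalSpace K] [IsNonarchimedeanLocalField K]

/-- Integrality of the idempotent in the basis g·p·shift says that ϖ^m divides the product of the
entries in the first column of p. One of them is a unit, so ϖ^m divides the other, which puts D on
the apartment of g. -/
theorem exists_shift_of_idem_mem {g : GL (Fin 2) K} {D : Vertex K} (h : idem g ∈ D.1) :
    ∃ j : ℤ, D = vertex (g * shift hϖ j) := by
  obtain ⟨p, m, hp, rfl⟩ := exists_relative_position_mul hϖ g D
  have hmem : (p : Matrix (Fin 2) (Fin 2) K) 1 0 * (p : Matrix (Fin 2) (Fin 2) K) 0 0 ∈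
      fracIdeal ϖ m := by
    have h1 := (mem_order_mul_shift hϖ).1 h
    have h2 := det_smul_coords p (coords g (idem g))
    rw [← coords_mul, coords_idem, Matrix.adjugate_fin_two] at h2
    have h3 := congrFun (congrFun h2 1) 0
    have hd : (p : Matrix (Fin 2) (Fin 2) K).det ∈ 𝒪[K] := by
      rw [Matrix.det_fin_two]
      exact sub_mem (mul_mem (hp.1 _ _) (hp.1 _ _)) (mul_mem (hp.1 _ _) (hp.1 _ _))
    have h4 := integer_mul_mem_fracIdeal hϖ hd h1.2.2.1
    rw [← neg_mem_iff]
    convert! h4 using 1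
    rw [Matrix.smul_apply, smul_eq_mul] at h3
    rw [h3]
    simp [Matrix.mul_apply]
  by_cases hy : (p : Matrix (Fin 2) (Fin 2) K) 1 0 ∈ fracIdeal ϖ 1
  · by_cases hx : (p : Matrix (Fin 2) (Fin 2) K) 0 0 ∈ fracIdeal ϖ 1
    · refine (one_notMem_fracIdeal hϖ one_pos ?_).elim
      have := integer_mul_mem_fracIdeal hϖ hp.2 (sub_mem
        (integer_mul_mem_fracIdeal hϖ (hp.1 1 1) hx) (integer_mul_mem_fracIdeal hϖ (hp.1 0 1) hy))
      rwa [mul_comm ((p : Matrix (Fin 2) (Fin 2) K) 1 1), ← Matrix.det_fin_two,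
        inv_mul_cancel₀ p.det_ne_zero] at this
    · have hx' := inv_mem_integers_of_notMem_fracIdeal hϖ (hp.1 0 0) hx
      refine ⟨m, vertex_eq_iff.2 (order_mul_shift_of_lower_mem hϖ g hp ?_)⟩
      have := integer_mul_mem_fracIdeal hϖ hx' hmem
      have hx0 : (p : Matrix (Fin 2) (Fin 2) K) 0 0 ≠ 0 := fun h => hx (h ▸ zero_mem _)
      rwa [mul_comm (_ : K) ((p : Matrix (Fin 2) (Fin 2) K) 0 0), inv_mul_cancel_left₀ hx0] at this
  · have hy' := inv_mem_integers_of_notMem_fracIdeal hϖ (hp.1 1 0) hy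
    refine ⟨-m, vertex_eq_iff.2 (order_mul_shift_of_upper_mem hϖ g hp ?_)⟩
    have := integer_mul_mem_fracIdeal hϖ hy' hmem
    have hy0 : (p : Matrix (Fin 2) (Fin 2) K) 1 0 ≠ 0 := fun h => hy (h ▸ zero_mem _)
    rwa [inv_mul_cancel_left₀ hy0] at this

/-- The idempotent places D on the apartment; the nilpotents e₀₁ and ϖ^n e₁₀ of the intersection
give 0 ≤ j and j ≤ n. -/
theorem exists_shift_of_inf_le {g : GL (Fin 2) K} {n : ℕ} {D : Vertex K}
    (h : order g ⊓ order (g * shift hϖ n) ≤ D.1) :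
    ∃ j : ℕ, j ≤ n ∧ D = vertex (g * shift hϖ j) := by
  have hn : (0 : ℤ) ≤ n := Int.natCast_nonneg n
  have hmem : ∀ x : Matrix (Fin 2) (Fin 2) K, (∀ i j, x i j ∈ 𝒪[K]) → x 1 0 ∈ fracIdeal ϖ n →
      (coords g).symm x ∈ D.1 := by
    intro x hx h10
    refine h ⟨fun i j => ?_, (mem_order_mul_shift hϖ).2 ?_⟩
    · rw [AlgEquiv.apply_symm_apply]
      exact hx i j
    · rw [AlgEquiv.apply_symm_apply]
      exact ⟨hx 0 0, fracIdeal_anti hϖ (by omega) (mem_fracIdeal_zero.2 (hx 0 1)), h10, hx 1 1⟩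
  obtain ⟨j, rfl⟩ := exists_shift_of_idem_mem hϖ (hmem !![1, 0; 0, 0]
    (integral_fin_two (one_mem _) (zero_mem _) (zero_mem _) (zero_mem _)) (zero_mem _))
  have h1 := hmem !![0, 1; 0, 0]
    (integral_fin_two (zero_mem _) (one_mem _) (zero_mem _) (zero_mem _)) (zero_mem _)
  have h2 := hmem !![0, 0; (ϖ : K) ^ (n : ℤ), 0]
    (integral_fin_two (zero_mem _) (zero_mem _) (mem_fracIdeal_zero.1
      ((zpow_mem_fracIdeal hϖ).2 hn)) (zero_mem _)) ((zpow_mem_fracIdeal hϖ).2 le_rfl)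
  replace h1 := ((mem_order_mul_shift hϖ).1 h1).2.1
  replace h2 := ((mem_order_mul_shift hϖ).1 h2).2.2.1
  rw [AlgEquiv.apply_symm_apply] at h1 h2
  have h3 : -j ≤ 0 := by
    by_contra hlt
    exact one_notMem_fracIdeal hϖ (not_le.1 hlt) h1
  have h4 : j ≤ n := (zpow_mem_fracIdeal hϖ).1 h2
  lift j to ℕ using by omega
  exact ⟨j, by omega, rfl⟩

variable {H : Subalgebra 𝒪[K] (Matrix (Fin 2) (Fin 2) K)}

omit [TopologicalSpace K] [IsNonarchimedeanLocalField K] in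
theorem deepening_le (s : ℕ) : deepening ϖ s H ≤ H := by
  rintro _ ⟨c, h, hh, rfl⟩
  exact add_mem (H.algebraMap_mem c) (H.smul_mem hh _)

omit [TopologicalSpace K] [IsNonarchimedeanLocalField K] in
include hϖ in
-- Scalars from K absorb the summand 𝒪, so passing to H^{[t]} only raises the depth by t.
theorem isDeep_deepening {r : ℤ} {t : ℕ} {D : Vertex K} :
    IsDeep ϖ r (deepening ϖ t H) D ↔ IsDeep ϖ (r - t) H D := by
  have h0 := uniformizer_ne_zero hϖ
  have hsmul : ∀ x : Matrix (Fin 2) (Fin 2) K, ϖ ^ t • x = (ϖ : K) ^ (t : ℤ) • x := by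
    intro x
    rw [zpow_natCast]
    rfl
  constructor
  · intro h x hx
    obtain ⟨c, d, hd, e⟩ := h (ϖ ^ t • x) ⟨0, x, hx, by simp⟩
    refine ⟨(ϖ : K) ^ (-(t : ℤ)) * c, d, hd, ?_⟩
    rw [hsmul] at e
    rw [map_mul, ← Algebra.smul_def, sub_eq_neg_add, zpow_add₀ h0, mul_smul, ← smul_add, ← e,
      smul_smul, ← zpow_add₀ h0, neg_add_cancel, zpow_zero, one_smul]
  · rintro h _ ⟨c, x, hx, rfl⟩
    obtain ⟨c', d, hd, e⟩ := h x hx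
    refine ⟨c + (ϖ : K) ^ (t : ℤ) * c', d, hd, ?_⟩
    rw [hsmul, e, smul_add, smul_smul, ← zpow_add₀ h0, add_sub_cancel, map_add, map_mul,
      ← Algebra.smul_def, add_assoc]
    rfl

include hϖ in
theorem exists_eichler_order (hH : IsOrder H) (hfin : {D : Vertex K | H ≤ D.1}.Finite) :
    ∃ D : Subalgebra 𝒪[K] (Matrix (Fin 2) (Fin 2) K), IsEichlerOrder D ∧
      ∃ t : ℕ, ∀ r : ℕ, branch ϖ r H = branch ϖ r (deepening ϖ t D) := by
  obtain ⟨F, hF⟩ := exists_depth_of_finite hϖ hH hfin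
  have hR := isRidge_depth hϖ hF
  have hT := isTree_tree hϖ
  obtain ⟨v, hv0, hmax⟩ := exists_max_depth_of_finite hH hfin hF
  lift F v to ℕ using hv0 with t ht
  have hPfin : {w | F w = t}.Finite := hfin.subset fun w hw => by
    change H ≤ w.1
    rw [← isDeep_zero_iff (ϖ := ϖ) hH, ← hF, show F w = t from hw]
    exact Int.natCast_nonneg t
  obtain ⟨I, f, hne, hord, hinj, hadj, hP⟩ := hR.isPathSet hT hmax ⟨v, ht.symm⟩
  have hIfin : I.Finite := Set.Finite.of_finite_image (hP ▸ hPfin) hinj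
  obtain ⟨a, ha, hamin⟩ := Set.exists_min_image I id hIfin hne
  obtain ⟨b, hb, hbmax⟩ := Set.exists_max_image I id hIfin hne
  simp only [id] at hamin hbmax
  have hFI : ∀ i ∈ I, F (f i) = t := fun i hi => by
    have : f i ∈ {w | F w = t} := hP ▸ ⟨i, hi, rfl⟩
    exact this
  have hab := hamin b hb
  obtain ⟨g, n, hga, hgb⟩ := exists_relative_position hϖ (f a) (f b)
  have hshift : ∀ j : ℕ, vertex (g * shift hϖ (j + 1 : ℕ)) =
      vertex (g * shift hϖ j * shift hϖ 1) := fun j => by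
    rw [Nat.cast_succ, ← shift_mul, ← mul_assoc]
  -- Equal vertices would have index 1, while ϖ²𝒪 is a proper subgroup of 𝒪.
  have hshift2 : ∀ j : ℕ, vertex (g * shift hϖ j) ≠ vertex (g * shift hϖ (j + 2 : ℕ)) := fun j => by
    intro e
    have h3 := orderIndex_shift hϖ (g * shift hϖ j) (n := 2) (by omega)
    rw [mul_assoc, shift_mul] at h3
    push_cast at e
    rw [← vertex_eq_iff.1 e, orderIndex, AddSubgroup.relIndex_self, eq_comm,
      AddSubgroup.relIndex_eq_one] at h3
    have := (zpow_mem_fracIdeal hϖ).1 (h3 ((zpow_mem_fracIdeal hϖ (r := 0) (s := 0)).2 le_rfl))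
    omega
  set E := order g ⊓ order (g * shift hϖ n) with hE
  have hEo : IsOrder E := (isOrder_order g).mono inf_le_left
  have hidem : idem g ∈ E := by
    refine ⟨idem_mem_order g, (mem_order_mul_shift hϖ).2 ?_⟩
    rw [coords_idem]
    exact ⟨one_mem _, zero_mem _, zero_mem _, zero_mem _⟩
  obtain ⟨F', hF'⟩ := exists_depth hϖ hEo ⟨_, hidem, idem_ne_algebraMap g⟩
  have hR' := isRidge_depth hϖ hF'
  have hmax' : ∀ w, F' w ≤ 0 := fun w => by
    by_contra hlt
    exact not_isDeep_one_of_idem_mem hϖ hidem w ((hF' w 1).1 (not_le.1 hlt))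
  have hE0 : ∀ w, 0 ≤ F' w ↔ E ≤ w.1 := fun w => by rw [hF', isDeep_zero_iff hEo]
  have ha' : 0 ≤ F' (f a) := by
    rw [hE0, hga]
    exact inf_le_left
  have hb' : 0 ≤ F' (f b) := by
    rw [hE0, hgb]
    exact inf_le_right
  -- Each inclusion is convexity of superlevel sets: along the path f for the depth of E, along the
  -- segment of shifts for the depth of H.
  have hPE : {w | F w = t} = {w | F' w = 0} := by
    ext w
    constructor
    · intro hw
      rw [hP] at hw
      obtain ⟨i, hi, rfl⟩ := hw
      have hai := hamin i hi
      have hib := hbmax i hi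
      refine le_antisymm (hmax' _) ?_
      have hI : ∀ k : ℕ, k ≤ (b - a).toNat → a + k ∈ I := fun k hk =>
        hord.out ha hb ⟨by omega, by omega⟩
      have := hR'.le_of_le_ends (k := 0) (n := (b - a).toNat) (s := fun k => f (a + k))
        (fun k hk => by
          have := hadj (a + k) (hI k (by omega))
          push_cast
          rw [← add_assoc]
          exact this (by simpa [add_assoc] using hI (k + 1) (by omega)))
        (fun k hk e => by
          have := hinj (hI k (by omega)) (hI (k + 2) (by omega)) e
          push_cast at this
          omega) (by simpa using ha')
        (by rwa [show a + ((b - a).toNat : ℤ) = b by omega]) (i - a).toNat (by omega)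
      rwa [show a + ((i - a).toNat : ℤ) = i by omega] at this
    · intro hw
      obtain ⟨j, hj, rfl⟩ := exists_shift_of_inf_le hϖ ((hE0 w).1 (le_of_eq hw.symm))
      refine le_antisymm ((hmax _).trans_eq rfl) ?_
      refine hR.le_of_le_ends (n := n) (s := fun k => vertex (g * shift hϖ k))
        (fun k _ => ?_) (fun k _ => hshift2 k) ?_ ?_ j hj
      · rw [hshift]
        exact adj_vertex_shift hϖ _
      · rw [Nat.cast_zero, shift_zero, mul_one, ← hga, hFI a ha]
      · rw [← hgb, hFI b hb]
  refine ⟨E, ⟨vertex g, vertex (g * shift hϖ n), rfl⟩, t, fun r => ?_⟩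
  ext w
  rw [mem_branch_iff hH, mem_branch_iff (hEo.mono (deepening_le t)), isDeep_deepening hϖ, ← hF,
    ← hF']
  -- For r ≤ t both branches are the (t - r)-neighbourhood of the common path; for r > t both are
  -- empty.
  rcases le_or_gt r t with hrt | hrt
  · have h1 := hR.setOf_le_eq hT.connected hmax ⟨v, ht.symm⟩ (k := r) (m := t - r) (by omega)
    have h2 := hR'.setOf_le_eq hT.connected hmax' ⟨f a, le_antisymm (hmax' _) ha'⟩
      (k := r - t) (m := t - r) (by omega)
    rw [hPE, ← h2] at h1
    exact Set.ext_iff.1 h1 w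
  · have := hmax w
    have := hmax' w
    omega

end Eichler

/-! ### Orders of maximal rank lie in finitely many maximal orders -/

section MaximalRank

variable {K : Type*} [Field K] [ValuativeRel K] {ϖ : 𝒪[K]} (hϖ : Irreducible ϖ)
  {H : Subalgebra 𝒪[K] (Matrix (Fin 2) (Fin 2) K)}
  [TopologicalSpace K] [IsNonarchimedeanLocalField K]
include hϖ

/-- Rank 4 makes H span the matrix algebra over K, and the matrices carried into H by all large
powers of ϖ form a K-subspace. -/
theorem exists_zpow_smul_mem (hH : IsOrder H) (hrank : Module.finrank 𝒪[K] H = 4)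
    (x : Matrix (Fin 2) (Fin 2) K) : ∃ N : ℕ, ∀ r : ℤ, N ≤ r → (ϖ : K) ^ r • x ∈ H := by
  have hfin : Module.Finite 𝒪[K] (Subalgebra.toSubmodule H) := Module.Finite.iff_fg.2 hH
  have hlat : Submodule.IsLattice K (Subalgebra.toSubmodule H) := by
    refine Submodule.IsLattice.of_rank_le K hH ?_
    have h1 : Module.finrank K (Matrix (Fin 2) (Fin 2) K) = 4 := by
      simp [Module.finrank_matrix]
    rw [← Module.finrank_eq_rank, ← Module.finrank_eq_rank, h1]
    exact_mod_cast hrank.ge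
  have hx : x ∈ Submodule.span K (Subalgebra.toSubmodule H : Set (Matrix (Fin 2) (Fin 2) K)) := by
    rw [hlat.span_eq_top]
    trivial
  have hint : ∀ c : K, c ∈ 𝒪[K] → ∀ y ∈ H, c • y ∈ H := fun c hc y hy => H.smul_mem hy ⟨c, hc⟩
  induction hx using Submodule.span_induction with
  | mem y hy =>
    refine ⟨0, fun r hr => hint _ ?_ y hy⟩
    rw [← mem_fracIdeal_zero (ϖ := ϖ), zpow_mem_fracIdeal hϖ]
    simpa using hr
  | zero => exact ⟨0, fun r _ => by rw [smul_zero]; exact zero_mem _⟩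
  | add y z _ _ hy hz =>
    obtain ⟨N, hN⟩ := hy
    obtain ⟨N', hN'⟩ := hz
    refine ⟨N + N', fun r hr => ?_⟩
    rw [smul_add]
    exact add_mem (hN r (by omega)) (hN' r (by omega))
  | smul c y _ hy =>
    obtain ⟨N, hN⟩ := hy
    obtain ⟨m, hm⟩ := exists_mem_fracIdeal hϖ c
    refine ⟨N + m, fun r hr => ?_⟩
    have h1 : (ϖ : K) ^ (m : ℤ) * c ∈ 𝒪[K] := by
      rwa [← mem_fracIdeal_zero (ϖ := ϖ), zpow_mul_mem_fracIdeal hϖ, zero_sub]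
    have := hint _ h1 _ (hN (r - m) (by omega))
    rwa [smul_smul, mul_right_comm, ← zpow_add₀ (uniformizer_ne_zero hϖ), add_sub_cancel,
      mul_smul] at this

/-- Multiplication by ϖ^{-N} maps 𝒪/ϖ^{2N}𝒪, which is finite, onto this image. -/
theorem finite_image_fracIdeal (N : ℕ) :
    (QuotientAddGroup.mk' (fracIdeal ϖ N) '' (fracIdeal ϖ (-N) : Set K)).Finite := by
  have hfin : Finite (𝒪[K] ⧸ (𝓂[K] ^ (N + N))) :=
    have : Finite (𝒪[K] ⧸ 𝓂[K]) := inferInstanceAs (Finite 𝓀[K])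
    Ideal.finite_quotient_pow (IsNoetherian.noetherian _) _
  let f : 𝒪[K] →+ K ⧸ fracIdeal ϖ N :=
    (QuotientAddGroup.mk' (fracIdeal ϖ N)).comp
      ((AddMonoidHom.mulLeft ((ϖ : K) ^ (-(N : ℤ)))).comp (𝒪[K]).subtype.toAddMonoidHom)
  have hker : ∀ x ∈ Submodule.toAddSubgroup (𝓂[K] ^ (N + N)), f x = 0 := by
    intro x hx
    change x ∈ 𝓂[K] ^ (N + N) at hx
    rw [hϖ.maximalIdeal_eq, Ideal.span_singleton_pow, Ideal.mem_span_singleton] at hx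
    obtain ⟨y, rfl⟩ := hx
    refine (QuotientAddGroup.eq_zero_iff _).2 ?_
    change (ϖ : K) ^ (-(N : ℤ)) * ((ϖ ^ (N + N) * y : 𝒪[K]) : K) ∈ fracIdeal ϖ N
    rw [zpow_mul_mem_fracIdeal hϖ]
    refine ⟨y, ?_⟩
    push_cast
    rw [sub_neg_eq_add, ← Nat.cast_add, zpow_natCast]
  let F : 𝒪[K] ⧸ (𝓂[K] ^ (N + N)) →+ K ⧸ fracIdeal ϖ N :=
    QuotientAddGroup.lift (Submodule.toAddSubgroup (𝓂[K] ^ (N + N))) f hker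
  refine (Set.finite_range F).subset ?_
  rintro _ ⟨_, ⟨y, rfl⟩, rfl⟩
  exact ⟨QuotientAddGroup.mk y, rfl⟩

/-- Each D contains ϖ^M M₂(𝒪), hence is determined by its image modulo ϖ^M, a subset of a finite
set. -/
theorem finite_setOf_le_of_finrank (hH : IsOrder H) (hrank : Module.finrank 𝒪[K] H = 4) :
    {D : Vertex K | H ≤ D.1}.Finite := by
  choose N hN using fun p : Fin 2 × Fin 2 =>
    exists_zpow_smul_mem hϖ hH hrank (Matrix.single p.1 p.2 1)
  -- The sum is a common bound for the four exponents.
  let M : ℕ := ∑ p, N p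
  have hM : ∀ i j, (ϖ : K) ^ (M : ℤ) • Matrix.single i j (1 : K) ∈ H := fun i j =>
    hN (i, j) M (Nat.cast_le.2 (Finset.single_le_sum (f := N) (fun _ _ => Nat.zero_le _)
      (Finset.mem_univ (i, j))))
  let φ : Matrix (Fin 2) (Fin 2) K → Fin 2 → Fin 2 → K ⧸ fracIdeal ϖ M :=
    fun x i j => QuotientAddGroup.mk' (fracIdeal ϖ M) (x i j)
  have hsmall : ∀ x : Matrix (Fin 2) (Fin 2) K, (∀ i j, x i j ∈ fracIdeal ϖ M) → x ∈ H := by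
    intro x hx
    rw [Matrix.matrix_eq_sum_single x]
    refine sum_mem fun i _ => sum_mem fun j _ => ?_
    obtain ⟨y, hy⟩ := hx i j
    have := H.smul_mem (hM i j) y
    convert! this using 1
    rw [hy]
    ext a b
    change Matrix.single i j _ a b = (y : K) * ((ϖ : K) ^ (M : ℤ) * Matrix.single i j 1 a b)
    simp only [Matrix.single_apply]
    split_ifs <;> ring
  have hlarge : ∀ D ∈ {D : Vertex K | H ≤ D.1}, ∀ x ∈ D.1, ∀ i j,
      x i j ∈ fracIdeal ϖ (-M) := by
    intro D hD x hx i j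
    obtain ⟨g, rfl⟩ := vertex_surjective D
    -- Trace duality: pairing x with ϖ^M e_{ji} ∈ D shows that ϖ^M x_{ij} is integral.
    have := trace_mem_integers (mul_mem hx (hD (hM j i)))
    rw [Matrix.mul_smul, Matrix.trace_smul, Matrix.trace_mul_single] at this
    rw [← zero_sub, ← zpow_mul_mem_fracIdeal hϖ, mem_fracIdeal_zero]
    simpa using this
  let T : Set (Fin 2 → Fin 2 → K ⧸ fracIdeal ϖ M) := Set.pi Set.univ fun _ =>
    Set.pi Set.univ fun _ => QuotientAddGroup.mk' (fracIdeal ϖ M) '' (fracIdeal ϖ (-M) : Set K)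
  have hT : T.Finite := Set.Finite.pi fun _ => Set.Finite.pi fun _ => finite_image_fracIdeal hϖ M
  refine Set.Finite.of_finite_image (f := fun D : Vertex K => φ '' SetLike.coe D.1)
    (hT.finite_subsets.subset ?_) ?_
  · rintro _ ⟨D, hD, rfl⟩ _ ⟨x, hx, rfl⟩
    exact fun i _ j _ => ⟨_, hlarge D hD x hx i j, rfl⟩
  · have hle : ∀ D ∈ {D : Vertex K | H ≤ D.1}, ∀ D' ∈ {D : Vertex K | H ≤ D.1},
        φ '' SetLike.coe D.1 = φ '' SetLike.coe D'.1 → D.1 ≤ D'.1 := by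
      intro D hD D' hD' e x hx
      obtain ⟨y, hy, hxy⟩ : φ x ∈ φ '' SetLike.coe D'.1 := e ▸ ⟨x, hx, rfl⟩
      have : x - y ∈ D'.1 := hD' (hsmall _ fun i j => by
        have h1 := congrFun (congrFun hxy i) j
        have h2 := QuotientAddGroup.eq.1 h1
        rwa [neg_add_eq_sub] at h2)
      simpa using add_mem this hy
    intro D hD D' hD' e
    exact Subtype.ext (le_antisymm (hle D hD D' hD' e) (hle D' hD' D hD e.symm))

end MaximalRank

/-! ### Branches as superlevel sets of the depth -/

section Branches

variable {K : Type*} [Field K] [ValuativeRel K] {ϖ : 𝒪[K]} (hϖ : Irreducible ϖ)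
  {H : Subalgebra 𝒪[K] (Matrix (Fin 2) (Fin 2) K)}
  [TopologicalSpace K] [IsNonarchimedeanLocalField K]
include hϖ

theorem isThickPath_branch (hH : IsOrder H) {r : ℕ} (hne : (branch ϖ r H).Nonempty)
    (hempty : branch ϖ (r + 1) H = ∅) {k : ℕ} (hk : k ≤ r) :
    IsThickPath (tree K) (r - k) (branch ϖ k H) := by
  have hnot : ∀ D : Vertex K, ¬ IsDeep ϖ (r + 1 : ℕ) H D := fun D hD => by
    have : D ∈ branch ϖ (r + 1) H := (mem_branch_iff hH).2 hD
    rw [hempty] at this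
    exact this
  obtain ⟨v, hv⟩ := hne
  obtain ⟨F, hF⟩ := exists_depth_of_not_isDeep hϖ hH (hnot v)
  have hmax : ∀ w, F w ≤ r := fun w => by
    by_contra hlt
    exact hnot w ((hF w _).1 (by push_cast; omega))
  have hv' : F v = r := le_antisymm (hmax v) ((hF v r).2 ((mem_branch_iff hH).1 hv))
  have hb : branch ϖ k H = {w | (k : ℤ) ≤ F w} := by
    ext w
    rw [mem_branch_iff hH, ← hF]
    rfl
  rw [hb]
  exact (isRidge_depth hϖ hF).isThickPath (isTree_tree hϖ) hmax ⟨v, hv'⟩ (by omega)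

end Branches

end BruhatTits

theorem corollary5p4 {K : Type*} [Field K] [ValuativeRel K] [TopologicalSpace K]
    [IsNonarchimedeanLocalField K] (ϖ : 𝒪[K]) (hϖ : Irreducible ϖ)
    (H : Subalgebra 𝒪[K] (Matrix (Fin 2) (Fin 2) K)) (hH : BruhatTits.IsOrder H) :
    (∀ r : ℕ, (BruhatTits.branch ϖ r H).Nonempty → BruhatTits.branch ϖ (r + 1) H = ∅ →
      ∀ k ≤ r, BruhatTits.IsThickPath (BruhatTits.tree K) (r - k) (BruhatTits.branch ϖ k H)) ∧
    ({D : BruhatTits.Vertex K | H ≤ D.1}.Finite →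
      ∃ D : Subalgebra 𝒪[K] (Matrix (Fin 2) (Fin 2) K), BruhatTits.IsEichlerOrder D ∧
        ∃ t : ℕ, ∀ r : ℕ, BruhatTits.branch ϖ r H =
          BruhatTits.branch ϖ r (BruhatTits.deepening ϖ t D)) ∧
    (Module.finrank 𝒪[K] H = 4 →
      {D : BruhatTits.Vertex K | H ≤ D.1}.Finite ∧
      ∃ D : Subalgebra 𝒪[K] (Matrix (Fin 2) (Fin 2) K), BruhatTits.IsEichlerOrder D ∧
        ∃ t : ℕ, ∀ r : ℕ, BruhatTits.branch ϖ r H =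
          BruhatTits.branch ϖ r (BruhatTits.deepening ϖ t D)) := by
  refine ⟨fun r hne hempty k hk => BruhatTits.isThickPath_branch hϖ hH hne hempty hk,
    BruhatTits.exists_eichler_order hϖ hH, fun hrank => ?_⟩
  have hfin := BruhatTits.finite_setOf_le_of_finrank hϖ hH hrank
  exact ⟨hfin, BruhatTits.exists_eichler_order hϖ hH hfin⟩
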